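/- **Setting.** An instance consists of a finite set $J$ of jobs, each with an integer release time $r_j\ge 0$, deadline $d_j$ and processing volume $p_j$, and of $m\ge 1$ processors $1,\dots,m$. Put $E_j=\{r_j,\dots,d_j\}$, $d=\max_j d_j$, $T=\{0,\dots,d\}$. A schedule is feasible if every job $j$ is processed in exactly $p_j$ slots, all in $E_j$, and never on two processors at once. A processor is busy at $t$ if it processes a job at $t$, otherwise idle; busy/idle intervals of a processor are inclusion-maximal nonempty intervals of $T$ on which it is busy/idle. A schedule has the stair-property if at every $t$, whenever processor $k$ is busy, all processors $k'\le k$ are busy. $\mathrm{vol}(Q)$ is the total number of job-units scheduled in $Q\subseteq T$, $\mathrm{fv}(Q)=\sum_j\max\{0,p_j-|E_j\setminus Q|\}$, $\phi(Q)=\mathrm{fv}(Q)/|Q|$, and $\hat\phi(Q)=\max_{\emptyset\ne Q'\subseteq Q}\phi(Q')$. **PLTR.** Start with $m_t=m$, $l_t=0$ for all $t$. For $k=m,\dots,1$: set $t=0$; while $t\le d$, first take the maximal $t'\in[t,d+1]$ such that a feasible schedule respecting $l_s\le \mathrm{vol}(s)\le m_s$ for all $s$ still exists after setting $m_s:=k-1$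 for $s\in[t,t')$, perform this update and put $t:=t'$; then do the same with the update $l_s:=\max\{k,l_s\}$ for $s\in[t,t')$. A schedule $S_{\mathrm{pltr}}$ returned by PLTR is a feasible schedule with the stair-property that respects the final bounds. **Critical sets.** An engagement of processor $k$ is the first slot of a busy interval on $k$. Fix critical sets $C_k\subseteq T$ for all processors $k$ of $S_{\mathrm{pltr}}$ that are not completely idle: $C_k$ contains $C_{k'}$ for all $k'>k$ and all engagements of $k$, satisfies $\mathrm{fv}(C_k)=\mathrm{vol}(C_k)$ and $\mathrm{vol}(t)\ge k-1$ for $t\in C_k$, and has maximal density $\phi$ among all sets with these properties. Let $\mathrm{crit}(t)$ be the largest $k$ with $t\in C_k$ ($0$ if there is none) and $\mathrm{crit}(D)=\max_{t\in D}\mathrm{crit}(t)$. A valley of $C=C_k$ is a nonempty gap between two consecutive maximal intervals of $C$. An interval $D$ is a section of $C$ if it contains at least one maximal interval of $C$ and contains each one that it meets; its left (right) valley is the valley of $C$ ending directly before $\min(C\cap D)$ (starting directly after $\max(C\cap D)$), if it exists. $J(V)$ is the set of jobs that $S_{\mathrm{pltr}}$ schedules in every slot of $V$. **Realignment.** $S_{\mathrm{aug}}$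 arises from $S_{\mathrm{pltr}}$ by making processor $k$ busy by an auxiliary slot (which carries no job) at every $t$ with $k=\mathrm{crit}(t)\ge 2$ and $\mathrm{vol}(t)=k-1$. To close an interval $V$ on $k$: for each $t\in V$ at which $k$ is idle, move the busy slot of the highest busy processor among $1,\dots,k-1$ to $k$, or, if these are all idle at $t$, make $k$ busy by a new auxiliary slot. $S_{\mathrm{real}}$ is obtained from $S_{\mathrm{aug}}$ as follows, with initial supply $\mathrm{res}(V)=2|J(V)|$. For $k=m,\dots,1$ call $\mathrm{fill}(k,T)$ and then decrease $\mathrm{res}(V)$ by $1$ for every $V$ that intersects some valley closed on $k$. The call $\mathrm{fill}(k,V)$ does nothing if $\mathrm{crit}(V)\le 1$. Otherwise let $C=C_{\mathrm{crit}(V)}$. While there is a busy interval $B\subseteq V$ on $k$ with $\mathrm{crit}(B)=\mathrm{crit}(V)$ and $\hat\phi(B)\le k-1$, choose such a $B$ and close on $k$ the left valley of $C$ and $B$ if it exists and has positive supply, else the right valley if it exists and has positive supply. Afterwards call $\mathrm{fill}(k,V')$, in any order, for every maximal interval $V'$ of $V\setminus C$ that has not been closed on $k$. **Claim.** For every schedule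 $S_{\mathrm{pltr}}$ returned by PLTR and every choice of critical sets, a realigned schedule $S_{\mathrm{real}}$ exists (some execution of the realignment terminates). For every $S_{\mathrm{real}}$ resulting from a terminating execution, every feasible schedule $S_{\mathrm{opt}}$ with the stair-property (in particular every optimal schedule with the stair-property) and every processor $k$: every idle interval of $S_{\mathrm{opt}}$ on processor $k$ intersects at most two distinct idle intervals of $S_{\mathrm{real}}$ on processor $k$. -/

import Mathlib

namespace PLTR

/-! ### Problem instances and schedules -/

/-- An instance of deadline scheduling with parallel processors: every job `j` has an integer
release time, deadline and processing volume; there are `procs ≥ 1` processors. -/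
structure ProblemInstance (J : Type*) where
  procs : ℕ
  release : J → ℕ
  deadline : J → ℕ
  volume : J → ℕ
  procs_pos : 1 ≤ procs

/-- What a processor does in one time slot. An auxiliary busy slot carries no job but makes the
processor busy. Only the schedules built for the analysis contain auxiliary busy slots. -/
inductive Slot (J : Type*) where
  | idle : Slot J
  | aux : Slot J
  | job (j : J) : Slot J

/-- `S k t` is what processor `k` does in time slot `t`; the processors are `1, …, m`. -/
abbrev Schedule (J : Type*) := ℕ → ℕ → Slot J

/-- A nonempty integer interval. -/
def IsInterval (D : Finset ℕ) : Prop := ∃ a b : ℕ, a ≤ b ∧ D = Finset.Icc a b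

/-- `D` is an inclusion-maximal (nonempty) interval contained in `A`. -/
def IsMaxInterval (A D : Finset ℕ) : Prop := Maximal (fun D => IsInterval D ∧ D ⊆ A) D

namespace ProblemInstance

variable {J : Type*} [Fintype J] (I : ProblemInstance J)

/-- The last deadline `d`. -/
def lastDeadline : ℕ := Finset.univ.sup I.deadline

/-- The set `T = {0, …, d}` of time slots. -/
def slots : Finset ℕ := Finset.Icc 0 I.lastDeadline

/-- The execution interval `E_j = [r_j, d_j]`. -/
def exec (j : J) : Finset ℕ := Finset.Icc (I.release j) (I.deadline j)

open Classical in
/-- The slots at which processor `k` is busy. -/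
noncomputable def busySlots (S : Schedule J) (k : ℕ) : Finset ℕ :=
  I.slots.filter fun t => S k t ≠ Slot.idle

open Classical in
/-- The slots at which processor `k` is idle. -/
noncomputable def idleSlots (S : Schedule J) (k : ℕ) : Finset ℕ :=
  I.slots.filter fun t => S k t = Slot.idle

/-- `B` is a (full) busy interval on processor `k`. -/
def IsBusyInterval (S : Schedule J) (k : ℕ) (B : Finset ℕ) : Prop :=
  IsMaxInterval (I.busySlots S k) B

/-- `D` is a (full) idle interval on processor `k`. -/
def IsIdleInterval (S : Schedule J) (k : ℕ) (D : Finset ℕ) : Prop :=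
  IsMaxInterval (I.idleSlots S k) D

/-- Job `j` is scheduled at time `t`. -/
def Scheduled (S : Schedule J) (j : J) (t : ℕ) : Prop := ∃ k, S k t = Slot.job j

open Classical in
/-- `vol(j, Q)`: the number of slots of `Q` at which `j` is scheduled. -/
noncomputable def volJob (S : Schedule J) (j : J) (Q : Finset ℕ) : ℕ :=
  (Q.filter fun t => Scheduled S j t).card

/-- `vol(Q)`: the total volume scheduled in `Q`. Auxiliary busy slots do not count. -/
noncomputable def vol (S : Schedule J) (Q : Finset ℕ) : ℕ := ∑ j, volJob S j Q

/-- The forced volume `fv(j, Q) = max {0, p_j - |E_j ∖ Q|}` (truncated subtraction). -/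
def fvJob (j : J) (Q : Finset ℕ) : ℕ := I.volume j - (I.exec j \ Q).card

/-- `fv(Q)`, summed over all jobs. -/
def fv (Q : Finset ℕ) : ℕ := ∑ j, I.fvJob j Q

/-- The density `φ(Q) = fv(Q) / |Q|`. -/
def density (Q : Finset ℕ) : ℚ := (I.fv Q : ℚ) / (Q.card : ℚ)

/-- The peak density: the maximum of `φ(Q')` over `Q' ⊆ Q`. The empty set contributes the
value `0`, which does not matter for nonempty `Q` since densities are nonnegative. -/
def peakDensity (Q : Finset ℕ) : ℚ :=
  Q.powerset.sup' ⟨∅, Finset.empty_mem_powerset Q⟩ I.density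

/-- A feasible schedule: only processors `1, …, m` are used, there are no auxiliary busy slots,
jobs run inside their execution intervals, no job runs on two processors at the same time, and
every job `j` runs for exactly `p_j` slots. -/
structure Feasible (S : Schedule J) : Prop where
  idle_off_range : ∀ k t, k ∉ Finset.Icc 1 I.procs → S k t = Slot.idle
  no_aux : ∀ k t, S k t ≠ Slot.aux
  mem_exec : ∀ k t j, S k t = Slot.job j → t ∈ I.exec j
  no_parallel : ∀ k k' t j, S k t = Slot.job j → S k' t = Slot.job j → k = k'
  volume_eq : ∀ j, volJob S j I.slots = I.volume j

/-- The stair-property: lower numbered processors are used first. -/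
def Stair (S : Schedule J) : Prop :=
  ∀ t ∈ I.slots, ∀ k ∈ Finset.Icc 1 I.procs, S k t ≠ Slot.idle →
    ∀ k' ∈ Finset.Icc 1 k, S k' t ≠ Slot.idle

end ProblemInstance

/-! ### The algorithm Parallel Left-to-Right -/

/-- Lower bounds `l_t` and upper bounds `m_t` for the number of busy processors. -/
structure Bounds where
  lower : ℕ → ℕ
  upper : ℕ → ℕ

/-- Set `m_s` to `k - 1` for all `s ∈ [t, t')`. -/
def Bounds.keepIdle (b : Bounds) (k t t' : ℕ) : Bounds where
  lower := b.lower
  upper := fun s => if t ≤ s ∧ s < t' then k - 1 else b.upper s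

/-- Set `l_s` to `max {k, l_s}` for all `s ∈ [t, t')`. -/
def Bounds.keepBusy (b : Bounds) (k t t' : ℕ) : Bounds where
  lower := fun s => if t ≤ s ∧ s < t' then max k (b.lower s) else b.lower s
  upper := b.upper

namespace ProblemInstance

variable {J : Type*} [Fintype J] (I : ProblemInstance J)

/-- There is a feasible schedule whose number of busy processors respects the bounds. -/
def BoundsFeasible (b : Bounds) : Prop :=
  ∃ S : Schedule J, I.Feasible S ∧
    ∀ t ∈ I.slots, b.lower t ≤ vol S {t} ∧ vol S {t} ≤ b.upper t

/-- The while-loop for processor `k`, from time `t` and bounds `b` to the final bounds.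
The new time `t'` ranges over `[t, d + 1]`; the case `t' = t` of `keepIdle` (empty range) occurs
if processor `k` has to be busy at time `0`. -/
inductive PltrRow (k : ℕ) : ℕ → Bounds → Bounds → Prop
  | done {t : ℕ} {b : Bounds} : I.lastDeadline < t → PltrRow k t b b
  | step {t t₁ t₂ : ℕ} {b b' : Bounds} :
      t ≤ I.lastDeadline →
      IsGreatest {t' | t ≤ t' ∧ t' ≤ I.lastDeadline + 1 ∧
        I.BoundsFeasible (b.keepIdle k t t')} t₁ →
      IsGreatest {t' | t₁ ≤ t' ∧ t' ≤ I.lastDeadline + 1 ∧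
        I.BoundsFeasible ((b.keepIdle k t t₁).keepBusy k t₁ t')} t₂ →
      PltrRow k t₂ ((b.keepIdle k t t₁).keepBusy k t₁ t₂) b' →
      PltrRow k t b b'

/-- The for-loop over the processors `k, k - 1, …, 1`. -/
inductive PltrRows : ℕ → Bounds → Bounds → Prop
  | zero {b : Bounds} : PltrRows 0 b b
  | succ {k : ℕ} {b b₁ b' : Bounds} :
      I.PltrRow (k + 1) 0 b b₁ → PltrRows k b₁ b' → PltrRows (k + 1) b b'

/-- `S` is a schedule returned by the algorithm: a feasible schedule with the stair-property
that respects the bounds with which the algorithm ends. -/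
def IsPltrSchedule (S : Schedule J) : Prop :=
  I.Feasible S ∧ I.Stair S ∧
    ∃ b : Bounds, I.PltrRows I.procs ⟨fun _ => 0, fun _ => I.procs⟩ b ∧
      ∀ t ∈ I.slots, b.lower t ≤ vol S {t} ∧ vol S {t} ≤ b.upper t

/-! ### Critical sets and valleys -/

/-- `t` is an engagement of processor `k`. -/
def IsEngagement (S : Schedule J) (k t : ℕ) : Prop :=
  ∃ B, I.IsBusyInterval S k B ∧ IsLeast (B : Set ℕ) t

/-- The processors that are not completely idle. -/
def IsUsed (S : Schedule J) (k : ℕ) : Prop :=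
  k ∈ Finset.Icc 1 I.procs ∧ (I.busySlots S k).Nonempty

/-- The conditions on a critical set for processor `k` apart from the maximality of its density,
where `C k'` are the critical sets for the processors `k' > k`. -/
structure IsCandidate (S : Schedule J) (C : ℕ → Finset ℕ) (k : ℕ) (Q : Finset ℕ) : Prop where
  subset_slots : Q ⊆ I.slots
  nested : ∀ k', k < k' → I.IsUsed S k' → C k' ⊆ Q
  engagement : ∀ t, I.IsEngagement S k t → t ∈ Q
  tight : I.fv Q = vol S Q
  vol_ge : ∀ t ∈ Q, k - 1 ≤ vol S {t}

/-- `C k` is the critical set for processor `k`, for every processor `k` which is not completely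
idle. -/
def IsCriticalFamily (S : Schedule J) (C : ℕ → Finset ℕ) : Prop :=
  ∀ k, I.IsUsed S k →
    I.IsCandidate S C k (C k) ∧ ∀ Q, I.IsCandidate S C k Q → I.density Q ≤ I.density (C k)

open Classical in
/-- `crit(t)`: the largest `k` such that `t` is in the critical set for processor `k`, and `0`
if there is none. -/
noncomputable def crit (S : Schedule J) (C : ℕ → Finset ℕ) (t : ℕ) : ℕ :=
  ((Finset.Icc 1 I.procs).filter fun k => I.IsUsed S k ∧ t ∈ C k).sup id

/-- `crit(D)`: the maximum of `crit(t)` over `t ∈ D`. -/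
noncomputable def critSet (S : Schedule J) (C : ℕ → Finset ℕ) (D : Finset ℕ) : ℕ :=
  D.sup (I.crit S C)

open Classical in
/-- `J(V)`: the jobs scheduled in every slot of `V`. -/
noncomputable def jobsThrough (S : Schedule J) (V : Finset ℕ) : Finset J :=
  Finset.univ.filter fun j => ∀ t ∈ V, Scheduled S j t

end ProblemInstance

/-- `V` is a valley of `C`: the nonempty gap between two consecutive maximal intervals of `C`. -/
def IsValleyOf (C V : Finset ℕ) : Prop :=
  V.Nonempty ∧ Disjoint V C ∧ ∃ x ∈ C, ∃ y ∈ C, V = Finset.Ioo x y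

/-- The interval `D` is a section of `C`: it contains a maximal interval of `C`, and every maximal
interval of `C` that it meets. -/
def IsSection (C D : Finset ℕ) : Prop :=
  IsInterval D ∧ (∃ D', IsMaxInterval C D' ∧ D' ⊆ D) ∧
    ∀ D', IsMaxInterval C D' → (D' ∩ D).Nonempty → D' ⊆ D

/-- `V` is the left valley for `C` and its section `D`. -/
def IsLeftValley (C D V : Finset ℕ) : Prop :=
  IsSection C D ∧ IsValleyOf C V ∧
    ∃ t, IsGreatest (V : Set ℕ) t ∧ IsLeast ((C ∩ D : Finset ℕ) : Set ℕ) (t + 1)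

/-- `V` is the right valley for `C` and its section `D`. -/
def IsRightValley (C D V : Finset ℕ) : Prop :=
  IsSection C D ∧ IsValleyOf C V ∧
    ∃ t, IsGreatest ((C ∩ D : Finset ℕ) : Set ℕ) t ∧ IsLeast (V : Set ℕ) (t + 1)

/-! ### The augmented and the realigned schedule -/

open Classical in
/-- The highest busy processor among `1, …, k - 1` at time `t`, and `0` if there is none. -/
noncomputable def topBusy {J : Type*} (S : Schedule J) (k t : ℕ) : ℕ :=
  ((Finset.Ico 1 k).filter fun k' => S k' t ≠ Slot.idle).sup id

open Classical in
/-- The subroutine `close(k, V)`: at every `t ∈ V` at which processor `k` is idle, move the busy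
slot of the highest busy processor below `k` to processor `k`, or introduce a new auxiliary busy
slot on processor `k` if all processors below `k` are idle. -/
noncomputable def close {J : Type*} (k : ℕ) (V : Finset ℕ) (S : Schedule J) : Schedule J :=
  fun k' t =>
    if t ∈ V ∧ S k t = Slot.idle then
      if topBusy S k t = 0 then
        if k' = k then Slot.aux else S k' t
      else
        if k' = k then S (topBusy S k t) t
        else if k' = topBusy S k t then Slot.idle else S k' t
    else S k' t

/-- The current schedule, and the valleys closed so far on the current processor. -/
structure RealState (J : Type*) where
  sched : Schedule J
  closed : Finset (Finset ℕ)

/-- Close the valley `V` on processor `k`. -/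
noncomputable def RealState.closeValley {J : Type*} (s : RealState J) (k : ℕ) (V : Finset ℕ) :
    RealState J where
  sched := close k V s.sched
  closed := insert V s.closed

namespace ProblemInstance

variable {J : Type*} [Fintype J] (I : ProblemInstance J)

open Classical in
/-- The augmented schedule: an auxiliary busy slot on processor `k` at every `t` with
`k = crit(t) ≥ 2` and `vol(t) = k - 1`. -/
noncomputable def augment (S : Schedule J) (C : ℕ → Finset ℕ) : Schedule J :=
  fun k t =>
    if t ∈ I.slots ∧ k = I.crit S C t ∧ 2 ≤ k ∧ vol S {t} = k - 1 then Slot.aux else S k t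

/-- The busy intervals for which the while-loop of `fill(k, V)` is executed: `B ⊆ V` is a busy
interval on processor `k` of the current schedule `R` with `B ∼ V` and peak density at most
`k - 1`. -/
def IsLowBusy (S : Schedule J) (C : ℕ → Finset ℕ) (k : ℕ) (V : Finset ℕ) (R : Schedule J)
    (B : Finset ℕ) : Prop :=
  I.IsBusyInterval R k B ∧ B ⊆ V ∧ I.critSet S C B = I.critSet S C V ∧
    I.peakDensity B ≤ (k : ℚ) - 1

/-- One iteration of the while-loop of `fill(k, V)` which closes a valley. `C (crit V)` is the
critical set equivalent to `V`. -/
def CloseStep (S : Schedule J) (C : ℕ → Finset ℕ) (k : ℕ) (res : Finset ℕ → ℤ) (V : Finset ℕ)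
    (s s' : RealState J) : Prop :=
  ∃ B, I.IsLowBusy S C k V s.sched B ∧
    ((∃ W, IsLeftValley (C (I.critSet S C V)) B W ∧ 0 < res W ∧ s' = s.closeValley k W) ∨
      ((¬ ∃ W, IsLeftValley (C (I.critSet S C V)) B W ∧ 0 < res W) ∧
        ∃ W, IsRightValley (C (I.critSet S C V)) B W ∧ 0 < res W ∧ s' = s.closeValley k W))

/-- A terminating execution of the while-loop of `fill(k, V)`. -/
def WhileRun (S : Schedule J) (C : ℕ → Finset ℕ) (k : ℕ) (res : Finset ℕ → ℤ) (V : Finset ℕ)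
    (s s' : RealState J) : Prop :=
  Relation.ReflTransGen (I.CloseStep S C k res V) s s' ∧ ¬ ∃ B, I.IsLowBusy S C k V s'.sched B

/-- A terminating execution of the calls `fill(k, V)` for all `V` of a list, one after the other.
The recursive calls are made, in any order, for the maximal intervals `V'` of `V ∖ C` that have
not been closed on `k`. These are the valleys of `C` inside `V`, and, at the two ends of the time
horizon, the segments before the first and after the last slot of `C`. -/
inductive FillList (S : Schedule J) (C : ℕ → Finset ℕ) (k : ℕ) (res : Finset ℕ → ℤ) :
    List (Finset ℕ) → RealState J → RealState J → Prop
  | nil {s : RealState J} : FillList S C k res [] s s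
  | skip {V : Finset ℕ} {rest : List (Finset ℕ)} {s s' : RealState J} :
      I.critSet S C V ≤ 1 → FillList S C k res rest s s' → FillList S C k res (V :: rest) s s'
  | fill {V : Finset ℕ} {rest children : List (Finset ℕ)} {s s₁ s₂ s' : RealState J} :
      2 ≤ I.critSet S C V →
      I.WhileRun S C k res V s s₁ →
      children.Nodup →
      (∀ V', V' ∈ children ↔ IsMaxInterval (V \ C (I.critSet S C V)) V' ∧ V' ∉ s₁.closed) →
      FillList S C k res children s₁ s₂ →
      FillList S C k res rest s₂ s' →
      FillList S C k res (V :: rest) s s'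

open Classical in
/-- The update of the supply after `fill(k, T)`, where `closed` are the valleys closed on `k`. -/
noncomputable def updateRes (res : Finset ℕ → ℤ) (closed : Finset (Finset ℕ)) : Finset ℕ → ℤ :=
  fun V => if ∃ V' ∈ closed, (V' ∩ V).Nonempty then res V - 1 else res V

/-- The for-loop of the realignment over the processors `k, k - 1, …, 1`, from the schedule `R`
and the supply `res` to the resulting schedule. -/
inductive RealignRows (S : Schedule J) (C : ℕ → Finset ℕ) :
    ℕ → (Finset ℕ → ℤ) → Schedule J → Schedule J → Prop
  | zero {res : Finset ℕ → ℤ} {R : Schedule J} : RealignRows S C 0 res R R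
  | succ {k : ℕ} {res : Finset ℕ → ℤ} {R R' : Schedule J} {s : RealState J} :
      I.FillList S C (k + 1) res [I.slots] ⟨R, ∅⟩ s →
      RealignRows S C k (updateRes res s.closed) s.sched R' →
      RealignRows S C (k + 1) res R R'

/-- `R` is a realigned schedule obtained from the schedule `S` and its critical sets `C`. The
realignment may choose freely the busy intervals in the while-loops and the order of the recursive
calls. -/
def IsRealigned (S : Schedule J) (C : ℕ → Finset ℕ) (R : Schedule J) : Prop :=
  I.RealignRows S C I.procs (fun V => 2 * ((jobsThrough S V).card : ℤ)) (I.augment S C) R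

end ProblemInstance

end PLTR

namespace PLTR

/-! Call a busy interval `B` on processor `k` dense if some `Q ⊆ B` has forced volume above `(k - 1)
* |Q|`. Every feasible schedule then has volume at least `k` at some slot of `Q`, and with the
stair-property its processor `k` is busy there. An idle interval of the optimal schedule that met
three idle intervals of the realigned schedule on `k` would contain two complete busy intervals of
the latter, so neither of them could be dense. Realignment makes every busy interval of criticality
at least two dense (`FillList.not_low`). The remaining ones occur only for `k = 1` and are busy
intervals of the PLTR schedule that use processor 1 alone (`vol_of_critSet_le_one`). For two such
intervals, the greedy choices in the last row of PLTR confine the first job of the later one to the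
slots strictly between the two idle slots that follow the intervals
(`IsPltrSchedule.exists_vol_pos`). Every feasible schedule is therefore busy somewhere in that
range.

The realignment is tracked by counting. Let `χ` be the criticality, `n` the number of busy
processors of the augmented schedule, and `X t` the number of rows above `k` on which `t` was
closed. Row `k` is busy at `t` iff `k + X t ≤ n t` or `t` is closed on `k` (`RowState`). Closed
valleys lie between walls of larger `χ`. Hence a slot that dominates another one (`Sees`) is closed
at most as often, and if less often, its own criticality still covers row `k` (`RowInv`). It follows
that a most critical slot `y` of a basin satisfies `k + X y ≤ χ y` whenever it belongs to a busy
interval inside the basin (`add_le_of_mem`). Such intervals are then sections of the critical set,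
and the valleys next to them can be closed.

Existence of a terminating execution rests on the supply. For a section of `C c` of peak density at
most `k - 1`, counting volume gives `c < k + |J(left)| + |J(right)|`
(`lt_add_card_of_peakDensity_le`). A valley `V` next to it whose supply is exhausted satisfies `2 *
|J(V)| ≤ c - k`, so the two sides cannot both fail (`exists_closeStep`). Each closing makes further
slots of row `k` busy, so the loop ends. -/

/-! ### Intervals -/

/-- `z` is adjacent to `D`, but not in `D`. -/
def Adj (z : ℕ) (D : Finset ℕ) : Prop := z ∉ D ∧ (z + 1 ∈ D ∨ (1 ≤ z ∧ z - 1 ∈ D))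

theorem isInterval_uIcc (a b : ℕ) : IsInterval (Finset.uIcc a b) :=
  ⟨a ⊓ b, a ⊔ b, inf_le_sup, rfl⟩

theorem IsInterval.uIcc_subset {D : Finset ℕ} (h : IsInterval D) {a b : ℕ} (ha : a ∈ D)
    (hb : b ∈ D) : Finset.uIcc a b ⊆ D := by
  obtain ⟨u, v, _, rfl⟩ := h
  intro s hs
  simp only [Finset.mem_Icc, Finset.mem_uIcc] at *
  omega

theorem IsInterval.union {D E : Finset ℕ} (hD : IsInterval D) (hE : IsInterval E)
    (h : (D ∩ E).Nonempty) : IsInterval (D ∪ E) := by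
  obtain ⟨a, b, hab, rfl⟩ := hD
  obtain ⟨u, v, huv, rfl⟩ := hE
  obtain ⟨t, ht⟩ := h
  refine ⟨min a u, max b v, by omega, ?_⟩
  ext s
  simp only [Finset.mem_inter, Finset.mem_union, Finset.mem_Icc] at *
  omega

theorem IsInterval.nonempty {D : Finset ℕ} (h : IsInterval D) : D.Nonempty := by
  obtain ⟨a, b, hab, rfl⟩ := h
  exact Finset.nonempty_Icc.2 hab

/-- A path that leaves an interval crosses one of its two neighbours. Maximality of intervals is
therefore tested on adjacent slots only. -/
theorem IsInterval.exists_adj {V : Finset ℕ} (hV : IsInterval V) {u v : ℕ} (hu : u ∈ V)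
    (hv : v ∉ V) : ∃ z ∈ Finset.uIcc u v, Adj z V := by
  obtain ⟨a, b, hab, rfl⟩ := hV
  simp only [Finset.mem_Icc] at hu hv
  rcases lt_or_ge v a with h | h
  · refine ⟨a - 1, ?_, ?_⟩
    · simp only [Finset.mem_uIcc]; omega
    · simp only [Adj, Finset.mem_Icc]; omega
  · refine ⟨b + 1, ?_, ?_⟩
    · simp only [Finset.mem_uIcc]; omega
    · simp only [Adj, Finset.mem_Icc]; omega

theorem Adj.uIcc_subset {D : Finset ℕ} (hD : IsInterval D) {z u : ℕ} (hz : Adj z D)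
    (hu : u ∈ D) : Finset.uIcc u z ⊆ insert z D := by
  obtain ⟨a, b, hab, rfl⟩ := hD
  intro s hs
  simp only [Adj, Finset.mem_insert, Finset.mem_Icc, Finset.mem_uIcc] at *
  omega

theorem Adj.mem_or_adj {B V : Finset ℕ} {z : ℕ} (hz : Adj z B) (h : B ⊆ V) :
    z ∈ V ∨ Adj z V := by
  by_cases hzV : z ∈ V
  · exact Or.inl hzV
  · exact Or.inr ⟨hzV, hz.2.imp (fun h' => h h') (fun h' => ⟨h'.1, h h'.2⟩)⟩

namespace IsMaxInterval

variable {A D : Finset ℕ}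

theorem isInterval (h : IsMaxInterval A D) : IsInterval D := h.prop.1

theorem subset (h : IsMaxInterval A D) : D ⊆ A := h.prop.2

theorem subset_of_inter (hD : IsMaxInterval A D) {E : Finset ℕ} (hE : IsInterval E)
    (hEA : E ⊆ A) (h : (E ∩ D).Nonempty) : E ⊆ D := by
  have h1 : IsInterval (E ∪ D) ∧ E ∪ D ⊆ A :=
    ⟨hE.union hD.isInterval h, Finset.union_subset hEA hD.subset⟩
  exact Finset.subset_union_left.trans (hD.le_of_ge h1 Finset.subset_union_right)

theorem mem_of_uIcc (hD : IsMaxInterval A D) {u v : ℕ} (hu : u ∈ D)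
    (h : Finset.uIcc u v ⊆ A) : v ∈ D :=
  hD.subset_of_inter (isInterval_uIcc u v) h
    ⟨u, Finset.mem_inter.2 ⟨Finset.left_mem_uIcc, hu⟩⟩ Finset.right_mem_uIcc

theorem notMem_of_adj (hD : IsMaxInterval A D) {z : ℕ} (hz : Adj z D) : z ∉ A := by
  intro hzA
  obtain ⟨u, hu⟩ := hD.isInterval.nonempty
  exact hz.1 (hD.mem_of_uIcc hu ((hz.uIcc_subset hD.isInterval hu).trans
    (Finset.insert_subset hzA hD.subset)))

theorem of_adj (h : IsInterval D) (hDA : D ⊆ A) (hz : ∀ z, Adj z D → z ∉ A) :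
    IsMaxInterval A D := by
  refine ⟨⟨h, hDA⟩, ?_⟩
  rintro E ⟨hE, hEA⟩ hDE v hv
  by_contra hvD
  obtain ⟨u, hu⟩ := h.nonempty
  obtain ⟨z, hz', hzD⟩ := h.exists_adj hu hvD
  exact hz z hzD (hEA (hE.uIcc_subset (hDE hu) hv hz'))

theorem eq_of_mem {E : Finset ℕ} (hD : IsMaxInterval A D) (hE : IsMaxInterval A E) {t : ℕ}
    (htD : t ∈ D) (htE : t ∈ E) : D = E :=
  Finset.Subset.antisymm
    (hE.subset_of_inter hD.isInterval hD.subset ⟨t, Finset.mem_inter.2 ⟨htD, htE⟩⟩)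
    (hD.subset_of_inter hE.isInterval hE.subset ⟨t, Finset.mem_inter.2 ⟨htE, htD⟩⟩)

end IsMaxInterval

theorem exists_isMaxInterval {A : Finset ℕ} {t : ℕ} (ht : t ∈ A) :
    ∃ D, IsMaxInterval A D ∧ t ∈ D := by
  have hfin : {D : Finset ℕ | IsInterval D ∧ D ⊆ A}.Finite :=
    (A.powerset.finite_toSet).subset fun D hD => by simpa using hD.2
  have h0 : ({t} : Finset ℕ) ∈ {D : Finset ℕ | IsInterval D ∧ D ⊆ A} :=
    ⟨⟨t, t, le_rfl, by simp⟩, by simpa using ht⟩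
  obtain ⟨D, hD, hmax⟩ := hfin.exists_le_maximal h0
  exact ⟨D, hmax, hD (Finset.mem_singleton_self t)⟩

theorem exists_isMaxInterval_superset {A E : Finset ℕ} (hE : IsInterval E) (h : E ⊆ A) :
    ∃ D, IsMaxInterval A D ∧ E ⊆ D := by
  obtain ⟨u, hu⟩ := hE.nonempty
  obtain ⟨D, hD, huD⟩ := exists_isMaxInterval (h hu)
  exact ⟨D, hD, hD.subset_of_inter hE h ⟨u, Finset.mem_inter.2 ⟨hu, huD⟩⟩⟩

/-! ### The levels of the time slots and one row of the realignment -/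

/-- `χ` attains its maximum over the interval between `a` and `b` at `a`. -/
def Sees (χ : ℕ → ℕ) (a b : ℕ) : Prop := ∀ s ∈ Finset.uIcc a b, χ s ≤ χ a

/-- The relation between the criticality `χ` of the slots and the numbers `n` of busy
processors of the augmented schedule. -/
structure LevelData (d : ℕ) (χ n : ℕ → ℕ) : Prop where
  le_count : ∀ t ≤ d, 2 ≤ χ t → χ t ≤ n t
  le_sup : ∀ l A, 1 ≤ l → IsMaxInterval ((Finset.Icc 0 d).filter fun t => l ≤ n t) A →
    l ≤ A.sup χ

/-- The invariant for the numbers `X t` of processors above `k` on which `t` has been closed. -/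
structure RowInv (d : ℕ) (χ : ℕ → ℕ) (k : ℕ) (X : ℕ → ℕ) : Prop where
  mono : ∀ a b, a ≤ d → b ≤ d → Sees χ a b → X a ≤ X b
  strict : ∀ a b, a ≤ d → b ≤ d → Sees χ a b → X a < X b → k + X a ≤ χ a ∧ 2 ≤ χ a

/-- The properties of the valleys `W` which are closed on processor `k`. -/
def Closable (d : ℕ) (χ : ℕ → ℕ) (k : ℕ) (X : ℕ → ℕ) (W : Finset ℕ) : Prop :=
  ∃ x y c, W = Finset.Ioo x y ∧ x < y ∧ y ≤ d ∧ 2 ≤ c ∧ c ≤ χ x ∧ c ≤ χ y ∧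
    (∀ t ∈ W, χ t < c) ∧ k + X x ≤ c ∧ k + X y ≤ c

/-- The interval `V` of slots is bounded by slots of larger criticality. -/
structure IsBasin (d : ℕ) (χ : ℕ → ℕ) (V : Finset ℕ) : Prop where
  isInterval : IsInterval V
  le : ∀ t ∈ V, t ≤ d
  lt_of_adj : ∀ z ≤ d, Adj z V → V.sup χ < χ z

/-- The busy slots of processor `k` when the slots of `Z` have been closed on `k`. -/
def rowBusy (d : ℕ) (n : ℕ → ℕ) (k : ℕ) (X : ℕ → ℕ) (Z : Finset ℕ) : Finset ℕ :=
  (Finset.Icc 0 d).filter fun t => k + X t ≤ n t ∨ t ∈ Z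

theorem mem_rowBusy {d : ℕ} {n : ℕ → ℕ} {k : ℕ} {X : ℕ → ℕ} {Z : Finset ℕ} {t : ℕ} :
    t ∈ rowBusy d n k X Z ↔ t ≤ d ∧ (k + X t ≤ n t ∨ t ∈ Z) := by
  simp [rowBusy]

section Row

variable {d : ℕ} {χ n : ℕ → ℕ} {k : ℕ} {X : ℕ → ℕ} {W V B Z : Finset ℕ}

theorem Sees.of_mem_basin (hV : IsBasin d χ V) {y t : ℕ} (hy : y ∈ V) (hχ : χ y = V.sup χ)
    (ht : t ∈ V) : Sees χ y t := fun s hs => by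
  rw [hχ]; exact Finset.le_sup (hV.isInterval.uIcc_subset hy ht hs)

theorem Sees.of_adj_basin (hV : IsBasin d χ V) {z t : ℕ} (hz : Adj z V) (hzd : z ≤ d)
    (ht : t ∈ V) : Sees χ z t := fun s hs => by
  rw [Finset.uIcc_comm] at hs
  rcases Finset.mem_insert.1 (hz.uIcc_subset hV.isInterval ht hs) with rfl | h
  · exact le_rfl
  · exact (Finset.le_sup h).trans (hV.lt_of_adj z hzd hz).le

/-- The walls of `W` have criticality at least `c`, and the slots inside stay below `c`, so no inner
slot sees past a wall. -/
theorem Closable.mem_of_sees (hW : Closable d χ k X W) {t t' : ℕ} (ht : t ∈ W)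
    (h : Sees χ t t') : t' ∈ W := by
  obtain ⟨x, y, c, rfl, -, -, -, hx, hy, hc, -, -⟩ := hW
  have htc := hc t ht
  by_contra ht'
  simp only [Finset.mem_Ioo] at ht ht'
  rcases le_or_gt t' x with h1 | h1
  · have := h x (by simp only [Finset.mem_uIcc]; omega)
    omega
  · have := h y (by simp only [Finset.mem_uIcc]; omega)
    omega

/-- A slot that sees into `W` from outside also sees a wall `w`. Hence `X t₀ ≤ X w` and `k + X w ≤ c
≤ χ w ≤ χ t₀`. -/
theorem Closable.le_of_sees (hW : Closable d χ k X W) (hX : RowInv d χ k X) {t t₀ : ℕ}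
    (ht : t ∈ W) (h₀ : t₀ ≤ d) (hn : t₀ ∉ W) (h : Sees χ t₀ t) :
    k + X t₀ ≤ χ t₀ ∧ 2 ≤ χ t₀ := by
  obtain ⟨x, y, c, rfl, hxy, hyd, h2, hx, hy, hc, hkx, hky⟩ := hW
  simp only [Finset.mem_Ioo] at ht hn
  rcases le_or_gt t₀ x with h1 | h1
  · have hm : x ∈ Finset.uIcc t₀ t := by simp only [Finset.mem_uIcc]; omega
    have h3 := hX.mono t₀ x h₀ (by omega) fun s hs => h s (by
      simp only [Finset.mem_uIcc] at hs ⊢; omega)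
    have := h x hm
    omega
  · have hm : y ∈ Finset.uIcc t₀ t := by simp only [Finset.mem_uIcc]; omega
    have h3 := hX.mono t₀ y h₀ (by omega) fun s hs => h s (by
      simp only [Finset.mem_uIcc] at hs ⊢; omega)
    have := h y hm
    omega

/-- The left wall `x` is busy on row `k`, since `k + X x ≤ c ≤ χ x ≤ n x`. A busy interval that
meets the closed valley therefore spills over to `x`. -/
theorem Closable.not_subset (hL : LevelData d χ n) (hW : Closable d χ k X W) (hWZ : W ⊆ Z)
    (hB : IsMaxInterval (rowBusy d n k X Z) B) : ¬ B ⊆ W := by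
  intro hBW
  obtain ⟨u, hu⟩ := hB.isInterval.nonempty
  have huW := hBW hu
  obtain ⟨x, y, c, rfl, hxy, hyd, h2, hx, hy, hc, hkx, hky⟩ := hW
  have hxB : x ∈ B := by
    apply hB.mem_of_uIcc hu
    intro s hs
    rw [mem_rowBusy]
    simp only [Finset.mem_uIcc, Finset.mem_Ioo] at hs huW
    refine ⟨by omega, ?_⟩
    rcases eq_or_ne s x with rfl | hsx
    · have := hL.le_count s (by omega) (by omega)
      left; omega
    · right; apply hWZ; simp only [Finset.mem_Ioo]; omega
  exact absurd (hBW hxB) (by simp)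

/-- A busy interval on row `k` inside a basin `V` which has a slot `y` of the criticality of `V`
but not of high criticality is a busy interval of the augmented schedule. -/
theorem isMaxInterval_of_not_le (hL : LevelData d χ n) (hX : RowInv d χ k X)
    {closed : Finset (Finset ℕ)} (hcl : ∀ W ∈ closed, Closable d χ k X W)
    (hV : IsBasin d χ V) (hB : IsMaxInterval (rowBusy d n k X (closed.biUnion id)) B)
    (hBV : B ⊆ V) {y : ℕ} (hy : y ∈ B) (hχ : χ y = V.sup χ)
    (hnot : ¬ (k + X y ≤ χ y ∧ 2 ≤ χ y)) :
    IsMaxInterval ((Finset.Icc 0 d).filter fun t => k + X y ≤ n t) B ∧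
      ∀ t ∈ V, X t = X y := by
  have hyd := hV.le y (hBV hy)
  -- `y` sees all of `V`, so a slot closed more often than `y` would trigger `RowInv.strict` at `y`.
  have hXV : ∀ t ∈ V, X t = X y := fun t ht => by
    have hs := Sees.of_mem_basin hV (hBV hy) hχ ht
    have h1 := hX.mono y t hyd (hV.le t ht) hs
    by_contra hne
    exact hnot (hX.strict y t hyd (hV.le t ht) hs (by omega))
  have hZ : ∀ t ∈ V, t ∉ closed.biUnion id := fun t ht htZ => by
    obtain ⟨W, hW, htW⟩ := Finset.mem_biUnion.1 htZ
    have hs := Sees.of_mem_basin hV (hBV hy) hχ ht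
    by_cases hyW : y ∈ W
    · refine (hcl W hW).not_subset hL (Finset.subset_biUnion_of_mem id hW) hB fun s hs => ?_
      exact (hcl W hW).mem_of_sees hyW (Sees.of_mem_basin hV (hBV hy) hχ (hBV hs))
    · exact hnot ((hcl W hW).le_of_sees hX htW hyd hyW hs)
  refine ⟨IsMaxInterval.of_adj hB.isInterval (fun t ht => ?_) fun z hz hzA => ?_, hXV⟩
  · have h1 := mem_rowBusy.1 (hB.subset ht)
    have h2 := hXV t (hBV ht)
    have h3 := hZ t (hBV ht)
    simp only [Finset.mem_filter, Finset.mem_Icc]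
    have := h1.2.resolve_right h3
    omega
  · simp only [Finset.mem_filter, Finset.mem_Icc] at hzA
    apply hB.notMem_of_adj hz
    rw [mem_rowBusy]
    refine ⟨by omega, Or.inl ?_⟩
    -- In both cases `X z ≤ X y`: inside `V` the counts agree, and a neighbour of the basin sees
    -- `y`. So `k + X y ≤ n z` would make `z` busy on row `k`.
    rcases hz.mem_or_adj hBV with h | h
    · have := hXV z h
      omega
    · have := hX.mono z y (by omega) hyd
        (Sees.of_adj_basin hV h (by omega) (hBV hy))
      omega

/-- This is the inequality behind both closability and the supply bound. If it failed, `B` would be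
a maximal interval at level `k + X y` of the augmented schedule, and such an interval contains a
slot of criticality at least `k + X y`. -/
theorem add_le_of_mem (hL : LevelData d χ n) (hX : RowInv d χ k X) (hk : 1 ≤ k)
    {closed : Finset (Finset ℕ)} (hcl : ∀ W ∈ closed, Closable d χ k X W)
    (hV : IsBasin d χ V) (hB : IsMaxInterval (rowBusy d n k X (closed.biUnion id)) B)
    (hBV : B ⊆ V) {y : ℕ} (hy : y ∈ B) (hχ : χ y = V.sup χ) : k + X y ≤ χ y := by
  by_contra hlt
  have h := (isMaxInterval_of_not_le hL hX hcl hV hB hBV hy hχ (fun h => hlt h.1)).1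
  have h1 := hL.le_sup _ _ (hk.trans (Nat.le_add_right _ _)) h
  have h2 := Finset.sup_mono (f := χ) hBV
  omega

theorem exists_mem_eq_sup (hB : B.Nonempty) : ∃ y ∈ B, χ y = B.sup χ := by
  obtain ⟨y, hy, h⟩ := Finset.exists_mem_eq_sup B hB χ
  exact ⟨y, hy, h.symm⟩

/-- The invariant passes on to the next row. -/
theorem RowInv.next (hX : RowInv d χ (k + 1) X) {closed : Finset (Finset ℕ)}
    (hcl : ∀ W ∈ closed, Closable d χ (k + 1) X W) :
    RowInv d χ k fun t => X t + if t ∈ closed.biUnion id then 1 else 0 := by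
  have key : ∀ a b, Sees χ a b → a ∈ closed.biUnion id → b ∈ closed.biUnion id := by
    intro a b h ha
    obtain ⟨W, hW, haW⟩ := Finset.mem_biUnion.1 ha
    exact Finset.mem_biUnion.2 ⟨W, hW, (hcl W hW).mem_of_sees haW h⟩
  have key2 : ∀ a b, a ≤ d → Sees χ a b → a ∉ closed.biUnion id → b ∈ closed.biUnion id →
      k + 1 + X a ≤ χ a ∧ 2 ≤ χ a := by
    intro a b had h ha hb
    obtain ⟨W, hW, hbW⟩ := Finset.mem_biUnion.1 hb
    exact (hcl W hW).le_of_sees hX hbW had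
      (fun haW => ha (Finset.mem_biUnion.2 ⟨W, hW, haW⟩)) h
  constructor
  · intro a b ha hb h
    have h1 := hX.mono a b ha hb h
    have h2 := key a b h
    split_ifs <;> first | omega | tauto
  · intro a b ha hb h
    have h1 := hX.strict a b ha hb h
    have h2 := key a b h
    have h3 := key2 a b ha h
    split_ifs <;> intro hlt
    · have := h1 (by omega); omega
    · tauto
    · have := h3 ‹_› ‹_›; omega
    · have := h1 (by omega); omega

/-- The bound on the decrease of the supply passes on to the next row. -/
theorem dec_le_next (hX : RowInv d χ (k + 1) X) {closed : Finset (Finset ℕ)}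
    (hcl : ∀ W ∈ closed, Closable d χ (k + 1) X W) {t₀ N : ℕ} (h₀ : t₀ ≤ d)
    (hs : ∀ t ∈ W, Sees χ t₀ t) (hN : N ≤ max (X t₀) (χ t₀ - (k + 1))) :
    (N + if ∃ V' ∈ closed, (V' ∩ W).Nonempty then 1 else 0) ≤
      max (X t₀ + if t₀ ∈ closed.biUnion id then 1 else 0) (χ t₀ - k) := by
  by_cases h : ∃ V' ∈ closed, (V' ∩ W).Nonempty
  · rw [if_pos h]
    obtain ⟨V', hV', t, ht⟩ := h
    rw [Finset.mem_inter] at ht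
    -- Either `t₀` is closed as well, and the first entry of the maximum grows by one, or `t₀` sees
    -- a closed slot from outside. Then `k + 1 ≤ χ t₀`, so the second entry, not truncated, grows by
    -- one, and it also exceeds `X t₀`.
    by_cases hz : t₀ ∈ closed.biUnion id
    · rw [if_pos hz]; omega
    · rw [if_neg hz]
      have := (hcl V' hV').le_of_sees hX ht.1 h₀
        (fun h' => hz (Finset.mem_biUnion.2 ⟨V', hV', h'⟩)) (hs t ht.2)
      omega
  · rw [if_neg h]
    split_ifs <;> omega

end Row

end PLTR

namespace PLTR
namespace ProblemInstance

variable {J : Type*} [Fintype J] {I : ProblemInstance J} {S : Schedule J} {C : ℕ → Finset ℕ}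

/-! ### Volumes -/

theorem mem_slots {t : ℕ} : t ∈ I.slots ↔ t ≤ I.lastDeadline := by simp [slots]

theorem mem_busySlots {k t : ℕ} :
    t ∈ I.busySlots S k ↔ t ≤ I.lastDeadline ∧ S k t ≠ Slot.idle := by
  rw [← mem_slots]
  simp only [busySlots, Finset.mem_filter]

theorem busySlots_subset (k : ℕ) : I.busySlots S k ⊆ I.slots := fun _ ht =>
  mem_slots.2 (mem_busySlots.1 ht).1

theorem Feasible.le_lastDeadline (hS : I.Feasible S) {k t : ℕ} (h : S k t ≠ Slot.idle) :
    t ≤ I.lastDeadline := by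
  cases hj : S k t with
  | idle => exact absurd hj h
  | aux => exact absurd hj (hS.no_aux k t)
  | job j =>
    have := hS.mem_exec k t j hj
    rw [exec, Finset.mem_Icc] at this
    exact this.2.trans (Finset.le_sup (f := I.deadline) (Finset.mem_univ j))

theorem Feasible.mem_slots_of_scheduled (hS : I.Feasible S) {j : J} {t : ℕ}
    (h : Scheduled S j t) : t ∈ I.slots := by
  obtain ⟨k, hk⟩ := h
  exact mem_slots.2 (hS.le_lastDeadline (k := k) (by simp [hk]))

theorem Feasible.mem_exec_of_scheduled (hS : I.Feasible S) {j : J} {t : ℕ}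
    (h : Scheduled S j t) : t ∈ I.exec j := by
  obtain ⟨k, hk⟩ := h
  exact hS.mem_exec k t j hk

open Classical in
theorem vol_singleton (S : Schedule J) (t : ℕ) :
    vol S {t} = (Finset.univ.filter fun j => Scheduled S j t).card := by
  rw [vol, Finset.card_filter]
  refine Finset.sum_congr rfl fun j _ => ?_
  rw [volJob, Finset.filter_singleton]
  split_ifs <;> simp

theorem vol_eq_sum (S : Schedule J) (Q : Finset ℕ) : vol S Q = ∑ t ∈ Q, vol S {t} := by
  classical
  simp only [vol, volJob]
  rw [Finset.sum_comm]
  refine Finset.sum_congr rfl fun j _ => ?_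
  rw [Finset.card_filter]
  refine Finset.sum_congr rfl fun t _ => ?_
  rw [Finset.filter_singleton]
  split_ifs <;> simp

open Classical in
theorem Feasible.vol_singleton_eq (hS : I.Feasible S) (t : ℕ) :
    vol S {t} = ((Finset.Icc 1 I.procs).filter fun k => S k t ≠ Slot.idle).card := by
  rw [vol_singleton]
  symm
  have hjob : ∀ k, S k t ≠ Slot.idle → ∃ j, S k t = Slot.job j := fun k hk => by
    cases hj : S k t with
    | idle => exact absurd hj hk
    | aux => exact absurd hj (hS.no_aux k t)
    | job j => exact ⟨j, rfl⟩
  refine Finset.card_bij (fun k hk => (hjob k (Finset.mem_filter.1 hk).2).choose) ?_ ?_ ?_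
  · intro k hk
    have := (hjob k (Finset.mem_filter.1 hk).2).choose_spec
    exact Finset.mem_filter.2 ⟨Finset.mem_univ _, k, this⟩
  · intro k hk k' hk' h
    have h1 := (hjob k (Finset.mem_filter.1 hk).2).choose_spec
    have h2 := (hjob k' (Finset.mem_filter.1 hk').2).choose_spec
    rw [← h] at h2
    exact hS.no_parallel k k' t _ h1 h2
  · intro j hj
    obtain ⟨k, hk⟩ := (Finset.mem_filter.1 hj).2
    have hne : S k t ≠ Slot.idle := by simp [hk]
    have hk1 : k ∈ Finset.Icc 1 I.procs := by
      by_contra h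
      exact hne (hS.idle_off_range k t h)
    refine ⟨k, Finset.mem_filter.2 ⟨hk1, hne⟩, ?_⟩
    exact (Slot.job.inj (hk.symm.trans (hjob k hne).choose_spec)).symm

theorem Feasible.vol_le_procs (hS : I.Feasible S) (t : ℕ) : vol S {t} ≤ I.procs := by
  classical
  rw [hS.vol_singleton_eq]
  exact (Finset.card_filter_le _ _).trans (by simp)

/-- With the stair-property, the busy processors at `t` are `1, …, vol t`. -/
theorem Feasible.busy_iff (hS : I.Feasible S) (hst : I.Stair S) (k t : ℕ) :
    S k t ≠ Slot.idle ↔ 1 ≤ k ∧ k ≤ vol S {t} := by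
  classical
  rw [hS.vol_singleton_eq]
  set P := (Finset.Icc 1 I.procs).filter fun k => S k t ≠ Slot.idle with hP
  have hmem : ∀ k, S k t ≠ Slot.idle ↔ k ∈ P := fun k => by
    rw [hP, Finset.mem_filter]
    refine ⟨fun h => ⟨?_, h⟩, fun h => h.2⟩
    by_contra h'
    exact h (hS.idle_off_range k t h')
  have hdown : ∀ k ∈ P, Finset.Icc 1 k ⊆ P := fun k hk k' hk' => by
    have h := (hmem k).2 hk
    rw [← hmem]
    exact hst t (mem_slots.2 (hS.le_lastDeadline h)) k (Finset.mem_filter.1 hk).1 h k' hk'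
  rw [hmem]
  constructor
  · intro hk
    have h1 := Finset.card_le_card (hdown k hk)
    have h2 := Finset.mem_Icc.1 (Finset.mem_filter.1 hk).1
    simp only [Nat.card_Icc] at h1
    omega
  · rintro ⟨h1, h2⟩
    by_contra hk
    have h3 : P ⊆ Finset.Icc 1 (k - 1) := fun k' hk' => by
      have h4 := Finset.mem_Icc.1 (Finset.mem_filter.1 hk').1
      by_contra h5
      simp only [Finset.mem_Icc] at h5
      exact hk (hdown k' hk' (Finset.mem_Icc.2 ⟨h1, by omega⟩))
    have := Finset.card_le_card h3
    simp only [Nat.card_Icc] at this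
    omega

/-! ### Forced volumes -/

theorem Feasible.volJob_slots_le (hS : I.Feasible S) (j : J) (Q : Finset ℕ) :
    I.volume j ≤ volJob S j Q + (I.exec j \ Q).card := by
  classical
  rw [← hS.volume_eq j, volJob, volJob]
  refine (Finset.card_le_card fun t ht => ?_).trans (Finset.card_union_le _ _)
  rw [Finset.mem_filter] at ht
  have := hS.mem_exec_of_scheduled ht.2
  by_cases htQ : t ∈ Q <;> simp [htQ, ht.2, this]

theorem Feasible.fvJob_le (hS : I.Feasible S) (j : J) (Q : Finset ℕ) :
    I.fvJob j Q ≤ volJob S j Q := by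
  have := hS.volJob_slots_le j Q
  rw [fvJob]
  omega

theorem Feasible.fv_le (hS : I.Feasible S) (Q : Finset ℕ) : I.fv Q ≤ vol S Q :=
  Finset.sum_le_sum fun j _ => hS.fvJob_le j Q

open Classical in
theorem Feasible.volume_eq_add (hS : I.Feasible S) (j : J) (Q : Finset ℕ) :
    I.volume j = volJob S j Q + ((I.exec j \ Q).filter fun t => Scheduled S j t).card := by
  rw [← hS.volume_eq j, volJob, volJob, ← Finset.card_union_of_disjoint]
  · congr 1
    ext t
    simp only [Finset.mem_filter, Finset.mem_union, Finset.mem_sdiff]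
    constructor
    · intro h
      have := hS.mem_exec_of_scheduled h.2
      tauto
    · intro h
      have h' : Scheduled S j t := by tauto
      exact ⟨hS.mem_slots_of_scheduled h', h'⟩
  · rw [Finset.disjoint_left]
    intro t h1 h2
    simp only [Finset.mem_filter, Finset.mem_sdiff] at h1 h2
    exact h2.1.2 h1.1

theorem Feasible.fvJob_eq_of_scheduled (hS : I.Feasible S) {j : J} {Q : Finset ℕ}
    (h : ∀ t ∈ I.exec j, t ∉ Q → Scheduled S j t) : I.fvJob j Q = volJob S j Q := by
  classical
  have h1 := hS.volume_eq_add j Q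
  rw [Finset.filter_true_of_mem fun t ht => h t (Finset.mem_sdiff.1 ht).1
    (Finset.mem_sdiff.1 ht).2] at h1
  rw [fvJob]
  omega

/-- Positive volume rules out truncation in the forced volume. Equality then says that `j` uses up
every slot of its execution interval outside `Q`. -/
theorem Feasible.scheduled_of_fvJob_eq (hS : I.Feasible S) {j : J} {Q : Finset ℕ}
    (h : I.fvJob j Q = volJob S j Q) (hpos : 0 < volJob S j Q) {t : ℕ} (ht : t ∈ I.exec j)
    (htQ : t ∉ Q) : Scheduled S j t := by
  classical
  have h1 := hS.volume_eq_add j Q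
  rw [fvJob] at h
  have h2 : (I.exec j \ Q).filter (fun t => Scheduled S j t) = I.exec j \ Q :=
    Finset.eq_of_subset_of_card_le (Finset.filter_subset _ _) (by omega)
  have h3 : t ∈ I.exec j \ Q := Finset.mem_sdiff.2 ⟨ht, htQ⟩
  rw [← h2] at h3
  exact (Finset.mem_filter.1 h3).2

theorem Feasible.fvJob_eq_of_tight (hS : I.Feasible S) {Q : Finset ℕ} (h : I.fv Q = vol S Q)
    (j : J) : I.fvJob j Q = volJob S j Q :=
  (Finset.sum_eq_sum_iff_of_le fun j _ => hS.fvJob_le j Q).1 h j (Finset.mem_univ j)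

theorem volJob_le_card {J : Type*} (S : Schedule J) (j : J) (Q : Finset ℕ) : volJob S j Q ≤ Q.card := by
  classical
  exact Finset.card_filter_le _ _

theorem volJob_mono {J : Type*} (S : Schedule J) (j : J) {P Q : Finset ℕ} (h : P ⊆ Q) :
    volJob S j P ≤ volJob S j Q := by
  classical
  exact Finset.card_le_card (Finset.filter_subset_filter _ h)

theorem exists_scheduled_of_volJob_pos {J : Type*} {S : Schedule J} {j : J} {Q : Finset ℕ} (h : 0 < volJob S j Q) :
    ∃ t ∈ Q, Scheduled S j t := by
  classical
  obtain ⟨t, ht⟩ := Finset.card_pos.1 h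
  exact ⟨t, (Finset.mem_filter.1 ht).1, (Finset.mem_filter.1 ht).2⟩

theorem volJob_pos {J : Type*} {S : Schedule J} {j : J} {Q : Finset ℕ} {t : ℕ} (ht : t ∈ Q) (h : Scheduled S j t) :
    0 < volJob S j Q := by
  classical
  exact Finset.card_pos.2 ⟨t, Finset.mem_filter.2 ⟨ht, h⟩⟩

theorem scheduled_of_volJob_eq_card {J : Type*} {S : Schedule J} {j : J} {Q : Finset ℕ} (h : Q.card ≤ volJob S j Q) {t : ℕ}
    (ht : t ∈ Q) : Scheduled S j t := by
  classical
  have h2 : Q.filter (fun t => Scheduled S j t) = Q :=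
    Finset.eq_of_subset_of_card_le (Finset.filter_subset _ _) h
  rw [← h2] at ht
  exact (Finset.mem_filter.1 ht).2

theorem density_le_peakDensity {Q B : Finset ℕ} (h : Q ⊆ B) :
    I.density Q ≤ I.peakDensity B :=
  Finset.le_sup' I.density (Finset.mem_powerset.2 h)

theorem peakDensity_mono {B B' : Finset ℕ} (h : B ⊆ B') :
    I.peakDensity B ≤ I.peakDensity B' :=
  Finset.sup'_le _ _ fun _ hQ => density_le_peakDensity ((Finset.mem_powerset.1 hQ).trans h)

theorem fv_le_of_peakDensity_le {B Q : Finset ℕ} {k : ℕ} (hk : 1 ≤ k)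
    (h : I.peakDensity B ≤ (k : ℚ) - 1) (hQ : Q ⊆ B) (hne : Q.Nonempty) :
    I.fv Q ≤ (k - 1) * Q.card := by
  have h1 := (density_le_peakDensity (I := I) hQ).trans h
  have h2 : (0 : ℚ) < Q.card := by exact_mod_cast Finset.card_pos.2 hne
  rw [density, div_le_iff₀ h2] at h1
  have h3 : ((k - 1 : ℕ) : ℚ) = (k : ℚ) - 1 := by push_cast [hk]; ring
  rw [← h3] at h1
  exact_mod_cast h1

theorem exists_lt_fv_of_lt_peakDensity {B : Finset ℕ} {k : ℕ} (hk : 1 ≤ k)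
    (h : (k : ℚ) - 1 < I.peakDensity B) :
    ∃ Q ⊆ B, (k - 1) * Q.card < I.fv Q := by
  obtain ⟨Q, hQ, hlt⟩ := (Finset.lt_sup'_iff _).1 h
  refine ⟨Q, Finset.mem_powerset.1 hQ, ?_⟩
  have h3 : ((k - 1 : ℕ) : ℚ) = (k : ℚ) - 1 := by push_cast [hk]; ring
  rw [← h3, density] at hlt
  rcases Q.eq_empty_or_nonempty with rfl | hne
  · simp at hlt
    have : (0 : ℚ) ≤ ((k - 1 : ℕ) : ℚ) := Nat.cast_nonneg _
    linarith
  · have h2 : (0 : ℚ) < Q.card := by exact_mod_cast Finset.card_pos.2 hne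
    rw [lt_div_iff₀ h2] at hlt
    exact_mod_cast hlt

/-! ### Criticality -/

/-- Nesting turns each critical set into a superlevel set of `crit`, so the later arguments can work
with the function alone. -/
theorem IsCriticalFamily.mem_iff (hC : I.IsCriticalFamily S C) {c t : ℕ} (hc : I.IsUsed S c) :
    t ∈ C c ↔ c ≤ I.crit S C t := by
  classical
  constructor
  · intro h
    exact Finset.le_sup (f := id) (Finset.mem_filter.2 ⟨hc.1, hc, h⟩)
  · intro h
    have hc1 := (Finset.mem_Icc.1 hc.1).1
    obtain ⟨k, hk, hle⟩ := (Finset.le_sup_iff (f := id) (by simp; omega)).1 h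
    obtain ⟨-, hk, htk⟩ := Finset.mem_filter.1 hk
    rcases eq_or_lt_of_le hle with h | h
    · simp only [id] at h; rwa [h]
    · exact (hC c hc).1.nested k h hk htk

theorem isUsed_crit {t : ℕ} (h : 1 ≤ I.crit S C t) :
    I.IsUsed S (I.crit S C t) ∧ t ∈ C (I.crit S C t) := by
  classical
  have hne : ((Finset.Icc 1 I.procs).filter fun k => I.IsUsed S k ∧ t ∈ C k).Nonempty := by
    by_contra hne
    rw [Finset.not_nonempty_iff_eq_empty] at hne
    rw [crit, hne] at h
    simp at h
  obtain ⟨k, hk, he⟩ := Finset.exists_mem_eq_sup _ hne id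
  have he : I.crit S C t = k := he
  rw [he]
  exact (Finset.mem_filter.1 hk).2

theorem isUsed_critSet {V : Finset ℕ} (h : 1 ≤ I.critSet S C V) :
    I.IsUsed S (I.critSet S C V) := by
  have hne : V.Nonempty := by
    by_contra hne
    rw [Finset.not_nonempty_iff_eq_empty] at hne
    rw [critSet, hne] at h
    simp at h
  obtain ⟨t, _, ht⟩ := Finset.exists_mem_eq_sup V hne (I.crit S C)
  have ht : I.critSet S C V = _ := ht
  rw [ht] at h ⊢
  exact (isUsed_crit h).1

theorem IsCriticalFamily.crit_le_vol_add_one (hC : I.IsCriticalFamily S C) {t : ℕ} :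
    I.crit S C t ≤ vol S {t} + 1 := by
  rcases Nat.lt_or_ge (I.crit S C t) 1 with h | h
  · omega
  · obtain ⟨h1, h2⟩ := isUsed_crit h
    have := (hC _ h1).1.vol_ge t h2
    omega

/-- The number of busy processors of the augmented schedule at `t`. -/
noncomputable def augCount (I : ProblemInstance J) (S : Schedule J) (C : ℕ → Finset ℕ) (t : ℕ) :
    ℕ :=
  if 2 ≤ I.crit S C t ∧ vol S {t} + 1 = I.crit S C t then vol S {t} + 1 else vol S {t}

theorem augment_busy_iff (hS : I.Feasible S) (hst : I.Stair S) {k t : ℕ}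
    (ht : t ≤ I.lastDeadline) :
    I.augment S C k t ≠ Slot.idle ↔ 1 ≤ k ∧ k ≤ I.augCount S C t := by
  have h := hS.busy_iff hst k t
  unfold augment augCount
  have hts : t ∈ I.slots := mem_slots.2 ht
  by_cases hk : t ∈ I.slots ∧ k = I.crit S C t ∧ 2 ≤ k ∧ vol S {t} = k - 1
  · rw [if_pos hk, if_pos (by omega)]
    simp only [ne_eq, reduceCtorEq, not_false_eq_true, true_iff]
    omega
  · rw [if_neg hk, h]
    have hk' : ¬ (k = I.crit S C t ∧ 2 ≤ k ∧ vol S {t} = k - 1) := fun h => hk ⟨hts, h⟩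
    split_ifs <;> omega

theorem busySlots_eq_filter (hS : I.Feasible S) (hst : I.Stair S) {k : ℕ} (hk : 1 ≤ k) :
    I.busySlots S k = (Finset.Icc 0 I.lastDeadline).filter fun t => k ≤ vol S {t} := by
  ext t
  simp only [busySlots, slots, Finset.mem_filter]
  exact and_congr_right fun _ => (hS.busy_iff hst k t).trans (and_iff_right hk)

/-- A maximal interval at level `l` either contains a busy interval of the original schedule on `l`,
whose engagement lies in `C l`, or is busy on `l` only through auxiliary slots, whose criticality
equals the augmented count. -/
theorem levelData (hS : I.Feasible S) (hst : I.Stair S) (hC : I.IsCriticalFamily S C) :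
    LevelData I.lastDeadline (I.crit S C) (I.augCount S C) := by
  constructor
  · intro t _ h2
    have := hC.crit_le_vol_add_one (t := t)
    unfold augCount
    split_ifs <;> omega
  · intro l A hl hA
    by_cases h : ∃ t ∈ A, l ≤ vol S {t}
    · obtain ⟨t, htA, htl⟩ := h
      have htd : t ∈ I.busySlots S l := by
        rw [busySlots_eq_filter hS hst hl]
        have := hA.subset htA
        simp only [Finset.mem_filter] at this ⊢
        exact ⟨this.1, htl⟩
      have hl' : l ≤ I.procs := htl.trans (hS.vol_le_procs t)
      have hused : I.IsUsed S l := ⟨Finset.mem_Icc.2 ⟨hl, hl'⟩, t, htd⟩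
      obtain ⟨B, hB, htB⟩ := exists_isMaxInterval htd
      have hBA : B ⊆ A := by
        refine hA.subset_of_inter hB.isInterval (fun s hs => ?_)
          ⟨t, Finset.mem_inter.2 ⟨htB, htA⟩⟩
        have := hB.subset hs
        rw [busySlots_eq_filter hS hst hl] at this
        simp only [Finset.mem_filter] at this ⊢
        refine ⟨this.1, ?_⟩
        unfold augCount
        split_ifs <;> omega
      obtain ⟨u, huB⟩ := hB.isInterval.nonempty
      have hmin : IsLeast (B : Set ℕ) (B.min' ⟨u, huB⟩) := Finset.isLeast_min' B _
      have h1 := (hC l hused).1.engagement _ ⟨B, hB, hmin⟩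
      have h2 := (hC.mem_iff hused).1 h1
      exact h2.trans (Finset.le_sup (hBA hmin.1))
    · push Not at h
      obtain ⟨t, htA⟩ := hA.isInterval.nonempty
      have h1 := h t htA
      have h2 := (Finset.mem_filter.1 (hA.subset htA)).2
      unfold augCount at h2
      refine le_trans ?_ (Finset.le_sup htA)
      split_ifs at h2 <;> omega

end ProblemInstance

/-! ### Sections of critical sets -/

section Valley

variable {C B : Finset ℕ} {y₀ x : ℕ}

theorem exists_isLeftValley (hB : IsSection C B) (hy : IsLeast ((C ∩ B : Finset ℕ) : Set ℕ) y₀)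
    (hx : x ∈ C) (hxy : x < y₀) :
    ∃ x₀ ∈ C, x ≤ x₀ ∧ x₀ + 1 < y₀ ∧ IsLeftValley C B (Finset.Ioo x₀ y₀) := by
  have hne : (C.filter (· < y₀)).Nonempty := ⟨x, Finset.mem_filter.2 ⟨hx, hxy⟩⟩
  set x₀ := (C.filter (· < y₀)).max' hne with hx₀
  have h1 := Finset.mem_filter.1 (Finset.max'_mem _ hne)
  rw [← hx₀] at h1
  have hle : ∀ z ∈ C, z < y₀ → z ≤ x₀ := fun z hz hzy =>
    Finset.le_max' _ _ (Finset.mem_filter.2 ⟨hz, hzy⟩)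
  have hyCB := Finset.mem_inter.1 (Finset.mem_coe.1 hy.1)
  -- If `x₀` were directly before `y₀`, both would lie in one maximal interval of `C`. The section
  -- would contain it, against the minimality of `y₀`.
  have hlt : x₀ + 1 < y₀ := by
    by_contra hcon
    obtain ⟨D, hD, hyD⟩ := exists_isMaxInterval hyCB.1
    have hxD : x₀ ∈ D := by
      refine hD.mem_of_uIcc hyD fun s hs => ?_
      rw [Finset.mem_uIcc] at hs
      have : s = x₀ ∨ s = y₀ := by omega
      rcases this with rfl | rfl
      · exact h1.1
      · exact hyCB.1
    have hxB := hB.2.2 D hD ⟨y₀, Finset.mem_inter.2 ⟨hyD, hyCB.2⟩⟩ hxD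
    have := hy.2 (Finset.mem_coe.2 (Finset.mem_inter.2 ⟨h1.1, hxB⟩))
    omega
  refine ⟨x₀, h1.1, hle x hx hxy, hlt, hB, ⟨?_, ?_, x₀, h1.1, y₀, hyCB.1, rfl⟩, y₀ - 1, ?_, ?_⟩
  · exact ⟨x₀ + 1, by rw [Finset.mem_Ioo]; omega⟩
  · rw [Finset.disjoint_left]
    intro z hz hzC
    rw [Finset.mem_Ioo] at hz
    have := hle z hzC hz.2
    omega
  · refine ⟨by simp only [Finset.coe_Ioo, Set.mem_Ioo]; omega, fun z hz => ?_⟩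
    simp only [Finset.coe_Ioo, Set.mem_Ioo] at hz
    omega
  · have : y₀ - 1 + 1 = y₀ := by omega
    rwa [this]

theorem exists_isRightValley (hB : IsSection C B)
    (hy : IsGreatest ((C ∩ B : Finset ℕ) : Set ℕ) y₀) (hx : x ∈ C) (hxy : y₀ < x) :
    ∃ x₀ ∈ C, x₀ ≤ x ∧ y₀ + 1 < x₀ ∧ IsRightValley C B (Finset.Ioo y₀ x₀) := by
  have hne : (C.filter (y₀ < ·)).Nonempty := ⟨x, Finset.mem_filter.2 ⟨hx, hxy⟩⟩
  set x₀ := (C.filter (y₀ < ·)).min' hne with hx₀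
  have h1 := Finset.mem_filter.1 (Finset.min'_mem _ hne)
  rw [← hx₀] at h1
  have hle : ∀ z ∈ C, y₀ < z → x₀ ≤ z := fun z hz hzy =>
    Finset.min'_le _ _ (Finset.mem_filter.2 ⟨hz, hzy⟩)
  have hyCB := Finset.mem_inter.1 (Finset.mem_coe.1 hy.1)
  have hlt : y₀ + 1 < x₀ := by
    by_contra hcon
    obtain ⟨D, hD, hyD⟩ := exists_isMaxInterval hyCB.1
    have hxD : x₀ ∈ D := by
      refine hD.mem_of_uIcc hyD fun s hs => ?_
      rw [Finset.mem_uIcc] at hs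
      have : s = x₀ ∨ s = y₀ := by omega
      rcases this with rfl | rfl
      · exact h1.1
      · exact hyCB.1
    have hxB := hB.2.2 D hD ⟨y₀, Finset.mem_inter.2 ⟨hyD, hyCB.2⟩⟩ hxD
    have := hy.2 (Finset.mem_coe.2 (Finset.mem_inter.2 ⟨h1.1, hxB⟩))
    omega
  refine ⟨x₀, h1.1, hle x hx hxy, hlt, hB, ⟨?_, ?_, y₀, hyCB.1, x₀, h1.1, rfl⟩, y₀, hy, ?_, ?_⟩
  · exact ⟨y₀ + 1, by rw [Finset.mem_Ioo]; omega⟩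
  · rw [Finset.disjoint_left]
    intro z hz hzC
    rw [Finset.mem_Ioo] at hz
    have := hle z hzC hz.1
    omega
  · simp only [Finset.coe_Ioo, Set.mem_Ioo]; omega
  · intro z hz
    simp only [Finset.coe_Ioo, Set.mem_Ioo] at hz
    omega

end Valley

namespace ProblemInstance

variable {J : Type*} [Fintype J] {I : ProblemInstance J} {S : Schedule J} {C : ℕ → Finset ℕ}

/-- A job with forced volume in a critical set which can run both inside and outside of a section
runs through one of the valleys next to the section. -/
theorem mem_jobsThrough_of_crossing {Cc B : Finset ℕ} (hB : IsSection Cc B) {j : J} {p q : ℕ}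
    (hsched : ∀ t ∈ I.exec j, t ∉ Cc → Scheduled S j t) (hq : q ∈ I.exec j)
    (hqC : q ∈ Cc) (hqB : q ∈ B) (hp : p ∈ I.exec j) (hpC : p ∈ Cc) (hpB : p ∉ B) :
    ∃ W, (IsLeftValley Cc B W ∨ IsRightValley Cc B W) ∧ j ∈ jobsThrough S W := by
  classical
  have hne : (Cc ∩ B).Nonempty := ⟨q, Finset.mem_inter.2 ⟨hqC, hqB⟩⟩
  obtain ⟨a, b, hab, hBe⟩ := hB.1
  have hconv : ∀ s u v, u ∈ B → v ∈ B → u ≤ s → s ≤ v → s ∈ B := by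
    intro s u v hu hv h1 h2
    rw [hBe, Finset.mem_Icc] at *
    omega
  have key : ∀ W, (∀ t ∈ W, t ∉ Cc ∧ t ∈ I.exec j) → j ∈ jobsThrough S W := fun W hW =>
    Finset.mem_filter.2 ⟨Finset.mem_univ j, fun t ht => hsched t (hW t ht).2 (hW t ht).1⟩
  rw [exec, Finset.mem_Icc] at hp hq
  rcases lt_or_ge p q with hpq | hpq
  · have hy := Finset.isLeast_min' _ hne
    set y₀ := (Cc ∩ B).min' hne
    have hyB := (Finset.mem_inter.1 (Finset.mem_coe.1 hy.1)).2
    have hyq : y₀ ≤ q := hy.2 (Finset.mem_coe.2 (Finset.mem_inter.2 ⟨hqC, hqB⟩))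
    have hpy : p < y₀ := by
      by_contra hcon
      exact hpB (hconv p y₀ q hyB hqB (by omega) (by omega))
    obtain ⟨x₀, hx₀, hpx, hlt, hW⟩ := exists_isLeftValley hB hy hpC hpy
    refine ⟨_, Or.inl hW, key _ fun t ht => ⟨fun htC =>
      Finset.disjoint_left.1 hW.2.1.2.1 ht htC, ?_⟩⟩
    rw [Finset.mem_Ioo] at ht
    rw [exec, Finset.mem_Icc]
    omega
  · have hy := Finset.isGreatest_max' _ hne
    set y₀ := (Cc ∩ B).max' hne
    have hyB := (Finset.mem_inter.1 (Finset.mem_coe.1 hy.1)).2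
    have hyq : q ≤ y₀ := hy.2 (Finset.mem_coe.2 (Finset.mem_inter.2 ⟨hqC, hqB⟩))
    have hpy : y₀ < p := by
      by_contra hcon
      exact hpB (hconv p q y₀ hqB hyB (by omega) (by omega))
    obtain ⟨x₀, hx₀, hpx, hlt, hW⟩ := exists_isRightValley hB hy hpC hpy
    refine ⟨_, Or.inr hW, key _ fun t ht => ⟨fun htC =>
      Finset.disjoint_left.1 hW.2.1.2.1 ht htC, ?_⟩⟩
    rw [Finset.mem_Ioo] at ht
    rw [exec, Finset.mem_Icc]
    omega

/-- Sections of low density have many jobs running through the neighboring valleys. -/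
theorem lt_add_card_of_peakDensity_le (hS : I.Feasible S) (hst : I.Stair S)
    (hC : I.IsCriticalFamily S C) {c k : ℕ} (hc : I.IsUsed S c) {B : Finset ℕ}
    (hB : IsSection (C c) B) (hBc : ∀ t ∈ B, I.crit S C t ≤ c) (hk : 1 ≤ k)
    (hpeak : I.peakDensity B ≤ (k : ℚ) - 1) {Jl Jr : Finset J}
    (hl : ∀ W, IsLeftValley (C c) B W → jobsThrough S W ⊆ Jl)
    (hr : ∀ W, IsRightValley (C c) B W → jobsThrough S W ⊆ Jr) :
    c < k + Jl.card + Jr.card := by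
  classical
  -- If the strict inequality fails, the volume estimate on `Q` holds with equality throughout.
  -- Removing `Q` from `C c` then gives a denser candidate.
  by_contra hcon
  obtain ⟨hcand, hmax⟩ := hC c hc
  set Q := C c ∩ B with hQ
  have hQne : Q.Nonempty := by
    obtain ⟨D, hD, hDB⟩ := hB.2.1
    obtain ⟨u, hu⟩ := hD.isInterval.nonempty
    exact ⟨u, Finset.mem_inter.2 ⟨hD.subset hu, hDB hu⟩⟩
  have htight := hS.fvJob_eq_of_tight hcand.tight
  have hsched : ∀ j, 0 < volJob S j (C c) → ∀ t ∈ I.exec j, t ∉ C c → Scheduled S j t :=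
    fun j hj t ht htC => hS.scheduled_of_fvJob_eq (htight j) hj ht htC
  have hcross : ∀ j, 0 < volJob S j (C c) → ∀ q ∈ I.exec j, q ∈ Q → ∀ p ∈ I.exec j,
      p ∈ C c → p ∉ Q → j ∈ Jl ∨ j ∈ Jr := by
    intro j hj q hq hqQ p hp hpC hpQ
    have hqQ' := Finset.mem_inter.1 hqQ
    have hpB : p ∉ B := fun h => hpQ (Finset.mem_inter.2 ⟨hpC, h⟩)
    obtain ⟨W, hW | hW, hjW⟩ :=
      mem_jobsThrough_of_crossing hB (hsched j hj) hq hqQ'.1 hqQ'.2 hp hpC hpB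
    · exact Or.inl (hl W hW hjW)
    · exact Or.inr (hr W hW hjW)
  -- A job outside `Jl ∪ Jr` with volume in `Q` cannot run in the rest of `C c`, and it occupies all
  -- its slots outside `C c`. Its volume in `Q` is therefore forced. Any other job contributes at
  -- most `Q.card`.
  have hjob : ∀ j ∈ Finset.univ, volJob S j Q ≤ I.fvJob j Q +
      Q.card * ((if j ∈ Jl then 1 else 0) + if j ∈ Jr then 1 else 0) := by
    intro j _
    by_cases hj : j ∈ Jl ∨ j ∈ Jr
    · have := volJob_le_card S j Q
      rcases hj with hj | hj <;> rw [if_pos hj] <;> split_ifs <;> omega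
    · rcases Nat.eq_zero_or_pos (volJob S j Q) with h0 | hpos
      · omega
      · have hposC := hpos.trans_le (volJob_mono S j Finset.inter_subset_left)
        obtain ⟨q, hqQ, hqs⟩ := exists_scheduled_of_volJob_pos hpos
        have := hS.fvJob_eq_of_scheduled (j := j) (Q := Q) fun t ht htQ => by
          by_cases htC : t ∈ C c
          · exact absurd (hcross j hposC q (hS.mem_exec_of_scheduled hqs) hqQ t ht htC htQ) hj
          · exact hsched j hposC t ht htC
        omega
  have hsum : ∑ j, (I.fvJob j Q +
      Q.card * ((if j ∈ Jl then 1 else 0) + if j ∈ Jr then 1 else 0)) =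
      I.fv Q + Q.card * (Jl.card + Jr.card) := by
    rw [Finset.sum_add_distrib, ← Finset.mul_sum, Finset.sum_add_distrib]
    simp [fv]
  have hfv := fv_le_of_peakDensity_le hk hpeak (Finset.inter_subset_right (s₁ := C c)) hQne
  rw [← hQ] at hfv
  have hvolge : ∀ t ∈ Q, c - 1 ≤ vol S {t} := fun t ht =>
    hcand.vol_ge t (Finset.mem_inter.1 ht).1
  have hlow : ∑ _t ∈ Q, (c - 1) ≤ ∑ t ∈ Q, vol S {t} := Finset.sum_le_sum hvolge
  have hvolQ := vol_eq_sum S Q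
  have hup := Finset.sum_le_sum hjob
  have hvolQ' : vol S Q = ∑ j, volJob S j Q := rfl
  have hchain : (k - 1) * Q.card + Q.card * (Jl.card + Jr.card) ≤ (c - 1) * Q.card := by
    have : k - 1 + (Jl.card + Jr.card) ≤ c - 1 := by omega
    calc _ = (k - 1 + (Jl.card + Jr.card)) * Q.card := by ring
      _ ≤ _ := Nat.mul_le_mul_right _ this
  have hconst : ∑ _t ∈ Q, (c - 1) = (c - 1) * Q.card := by simp [mul_comm]
  -- Squeezing `vol S Q` between the lower bound by slots and the upper bound by jobs makes both
  -- estimates termwise equalities.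
  have hvoleq : ∀ t ∈ Q, c - 1 = vol S {t} :=
    (Finset.sum_eq_sum_iff_of_le hvolge).1 (by omega)
  have hjobeq := (Finset.sum_eq_sum_iff_of_le hjob).1 (by omega)
  have hthrough : ∀ j, j ∈ Jl ∨ j ∈ Jr → ∀ t ∈ Q, Scheduled S j t := by
    intro j hj t ht
    refine scheduled_of_volJob_eq_card ?_ ht
    rw [hjobeq j (Finset.mem_univ j)]
    rcases hj with hj | hj <;> rw [if_pos hj] <;> split_ifs <;> omega
  have hc1 := (Finset.mem_Icc.1 hc.1).1
  -- At an engagement of `c` the volume is at least `c`, whereas it is exactly `c - 1` on `Q`.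
  have heng : ∀ t, I.IsEngagement S c t → t ∈ C c \ Q ∧ c ≤ vol S {t} := by
    rintro t ⟨D, hD, ht⟩
    have h1 := hD.subset ht.1
    rw [busySlots_eq_filter hS hst hc1, Finset.mem_filter] at h1
    refine ⟨Finset.mem_sdiff.2 ⟨hcand.engagement t ⟨D, hD, ht⟩, fun htQ => ?_⟩, h1.2⟩
    have := hvoleq t htQ
    omega
  have hcand' : I.IsCandidate S C c (C c \ Q) := by
    refine ⟨Finset.sdiff_subset.trans hcand.subset_slots, fun k' hk' hused t ht => ?_,
      fun t ht => (heng t ht).1, ?_, fun t ht => hcand.vol_ge t (Finset.mem_sdiff.1 ht).1⟩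
    · refine Finset.mem_sdiff.2 ⟨hcand.nested k' hk' hused ht, fun htQ => ?_⟩
      have h1 := hBc t (Finset.mem_inter.1 htQ).2
      have h2 := (hC.mem_iff hused).1 ht
      omega
    · refine Finset.sum_congr rfl fun j _ => ?_
      rcases Nat.eq_zero_or_pos (volJob S j (C c \ Q)) with h0 | hpos
      · have := hS.fvJob_le j (C c \ Q)
        omega
      · have hposC := hpos.trans_le (volJob_mono S j Finset.sdiff_subset)
        obtain ⟨p, hpQ, hps⟩ := exists_scheduled_of_volJob_pos hpos
        rw [Finset.mem_sdiff] at hpQ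
        refine hS.fvJob_eq_of_scheduled fun t ht htQ => ?_
        by_cases htC : t ∈ C c
        · have htQ' : t ∈ Q := by
            by_contra h
            exact htQ (Finset.mem_sdiff.2 ⟨htC, h⟩)
          exact hthrough j (hcross j hposC t ht htQ' p (hS.mem_exec_of_scheduled hps)
            hpQ.1 hpQ.2) t htQ'
        · exact hsched j hposC t ht htC
  obtain ⟨u, hu⟩ := hc.2
  obtain ⟨D, hD, huD⟩ := exists_isMaxInterval hu
  have hmin : IsLeast (D : Set ℕ) (D.min' ⟨u, huD⟩) := Finset.isLeast_min' D _
  obtain ⟨hm, hmc⟩ := heng _ ⟨D, hD, hmin⟩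
  -- The average volume is `c - 1` on `Q` and larger on the rest, so deleting `Q` strictly raises
  -- the density.
  have hgt : ∑ _t ∈ C c \ Q, (c - 1) < ∑ t ∈ C c \ Q, vol S {t} :=
    Finset.sum_lt_sum (fun t ht => hcand.vol_ge t (Finset.mem_sdiff.1 ht).1)
      ⟨_, hm, by omega⟩
  have hsplit : ∑ t ∈ C c \ Q, vol S {t} + ∑ t ∈ Q, vol S {t} = ∑ t ∈ C c, vol S {t} :=
    Finset.sum_sdiff Finset.inter_subset_left
  have hcard : (C c \ Q).card + Q.card = (C c).card :=
    Finset.card_sdiff_add_card_eq_card Finset.inter_subset_left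
  have hden := hmax _ hcand'
  have hQsum : ∑ t ∈ Q, vol S {t} = (c - 1) * Q.card := by
    rw [← Finset.sum_congr rfl hvoleq, hconst]
  rw [density, density, hcand'.tight, hcand.tight, vol_eq_sum, vol_eq_sum S (C c), ← hsplit,
    hQsum, ← hcard] at hden
  have hconst' : ∑ _t ∈ C c \ Q, (c - 1) = (c - 1) * (C c \ Q).card := by simp [mul_comm]
  rw [hconst'] at hgt
  have hpos1 : 0 < (C c \ Q).card := Finset.card_pos.2 ⟨_, hm⟩
  have hpos2 : 0 < Q.card := Finset.card_pos.2 hQne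
  rw [div_le_div_iff₀ (by exact_mod_cast hpos1) (by positivity)] at hden
  have hden' : (∑ t ∈ C c \ Q, vol S {t}) * ((C c \ Q).card + Q.card) ≤
      ((∑ t ∈ C c \ Q, vol S {t}) + (c - 1) * Q.card) * (C c \ Q).card := by
    exact_mod_cast hden
  have := Nat.mul_lt_mul_of_pos_right hgt hpos2
  nlinarith

end ProblemInstance
end PLTR

namespace PLTR

/-! ### Valleys next to busy intervals of a row -/

section Row

variable {d : ℕ} {χ n : ℕ → ℕ} {k : ℕ} {X : ℕ → ℕ} {W V B Z : Finset ℕ}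

/-- Let `y` be a most critical slot of `B`. A neighbour `z` of at least that criticality would see
`y`, so `k + X z ≤ k + X y ≤ χ y ≤ χ z ≤ n z`. Then `z` would be busy on row `k`. -/
theorem lt_of_adj_busy (hL : LevelData d χ n) (hX : RowInv d χ k X) (hk : 1 ≤ k)
    {closed : Finset (Finset ℕ)} (hcl : ∀ W ∈ closed, Closable d χ k X W)
    (hV : IsBasin d χ V) (hB : IsMaxInterval (rowBusy d n k X (closed.biUnion id)) B)
    (hBV : B ⊆ V) (hc : B.sup χ = V.sup χ) (h2 : 2 ≤ V.sup χ) {z : ℕ} (hz : Adj z B)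
    (hzd : z ≤ d) : χ z < V.sup χ := by
  by_contra hlt
  obtain ⟨y, hy, hyχ⟩ := exists_mem_eq_sup (χ := χ) hB.isInterval.nonempty
  rw [hc] at hyχ
  have hyc := add_le_of_mem hL hX hk hcl hV hB hBV hy hyχ
  have hs : Sees χ z y := by
    rcases hz.mem_or_adj hBV with h | h
    · have := Finset.le_sup (f := χ) h
      exact Sees.of_mem_basin hV h (by omega) (hBV hy)
    · exact Sees.of_adj_basin hV h hzd (hBV hy)
  have h3 := hX.mono z y hzd (hV.le y (hBV hy)) hs
  have h4 := hL.le_count z hzd (by omega)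
  exact hB.notMem_of_adj hz (mem_rowBusy.2 ⟨hzd, Or.inl (by omega)⟩)

theorem isSection_of_busy (hL : LevelData d χ n) (hX : RowInv d χ k X) (hk : 1 ≤ k)
    {closed : Finset (Finset ℕ)} (hcl : ∀ W ∈ closed, Closable d χ k X W)
    (hV : IsBasin d χ V) (hB : IsMaxInterval (rowBusy d n k X (closed.biUnion id)) B)
    (hBV : B ⊆ V) (hc : B.sup χ = V.sup χ) (h2 : 2 ≤ V.sup χ) {Cc : Finset ℕ}
    (hCd : ∀ t ∈ Cc, t ≤ d) (hCc : ∀ t, t ∈ Cc ↔ V.sup χ ≤ χ t) : IsSection Cc B := by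
  have hsub : ∀ D, IsMaxInterval Cc D → (D ∩ B).Nonempty → D ⊆ B := by
    rintro D hD ⟨u, hu⟩ v hv
    rw [Finset.mem_inter] at hu
    by_contra hvB
    obtain ⟨z, hz, hzB⟩ := hB.isInterval.exists_adj hu.2 hvB
    have hzC := hD.subset (hD.isInterval.uIcc_subset hu.1 hv hz)
    have := lt_of_adj_busy hL hX hk hcl hV hB hBV hc h2 hzB (hCd z hzC)
    have := (hCc z).1 hzC
    omega
  refine ⟨hB.isInterval, ?_, hsub⟩
  obtain ⟨y, hy, hyχ⟩ := exists_mem_eq_sup (χ := χ) hB.isInterval.nonempty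
  obtain ⟨D, hD, hyD⟩ := exists_isMaxInterval ((hCc y).2 (by omega))
  exact ⟨D, hD, hsub D hD ⟨y, Finset.mem_inter.2 ⟨hyD, hy⟩⟩⟩

/-- The wall in `B` is covered by `add_le_of_mem`. The other wall sees it across the gap and has
been closed no more often. If the whole gap were busy, `B` would extend over it and contain both
walls. -/
theorem closable_of_gap (hL : LevelData d χ n) (hX : RowInv d χ k X) (hk : 1 ≤ k)
    {closed : Finset (Finset ℕ)} (hcl : ∀ W ∈ closed, Closable d χ k X W)
    (hV : IsBasin d χ V) (hB : IsMaxInterval (rowBusy d n k X (closed.biUnion id)) B)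
    (hBV : B ⊆ V) (h2 : 2 ≤ V.sup χ) {a b : ℕ} (hab : a < b) (hbd : b ≤ d)
    (ha : V.sup χ ≤ χ a) (hb : V.sup χ ≤ χ b) (hW : ∀ t ∈ Finset.Ioo a b, χ t < V.sup χ)
    (hor : a ∈ B ∨ b ∈ B) (hand : ¬ (a ∈ B ∧ b ∈ B)) :
    Closable d χ k X (Finset.Ioo a b) ∧
      ¬ Finset.Ioo a b ⊆ rowBusy d n k X (closed.biUnion id) := by
  have hW' : ∀ s, a < s → s < b → χ s < V.sup χ := fun s h1 h2 =>
    hW s (Finset.mem_Ioo.2 ⟨h1, h2⟩)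
  have hXab : k + X a ≤ V.sup χ ∧ k + X b ≤ V.sup χ := by
    rcases hor with h | h
    · have hχ : χ a = V.sup χ := le_antisymm (Finset.le_sup (hBV h)) ha
      have h1 := add_le_of_mem hL hX hk hcl hV hB hBV h hχ
      have h3 := hX.mono b a hbd (by omega) fun s hs => by
        rw [Finset.mem_uIcc] at hs
        rcases eq_or_ne s b with rfl | hsb
        · exact le_rfl
        rcases eq_or_ne s a with rfl | hsa
        · omega
        have := hW' s (by omega) (by omega)
        omega
      omega
    · have hχ : χ b = V.sup χ := le_antisymm (Finset.le_sup (hBV h)) hb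
      have h1 := add_le_of_mem hL hX hk hcl hV hB hBV h hχ
      have h3 := hX.mono a b (by omega) hbd fun s hs => by
        rw [Finset.mem_uIcc] at hs
        rcases eq_or_ne s b with rfl | hsb
        · omega
        rcases eq_or_ne s a with rfl | hsa
        · exact le_rfl
        have := hW' s (by omega) (by omega)
        omega
      omega
  refine ⟨⟨a, b, V.sup χ, rfl, hab, hbd, h2, ha, hb, hW, hXab⟩, fun hsub => hand ?_⟩
  have hna := hL.le_count a (by omega) (by omega)
  have hnb := hL.le_count b hbd (by omega)
  have hall : Finset.uIcc a b ⊆ rowBusy d n k X (closed.biUnion id) := fun s hs => by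
    rw [Finset.mem_uIcc] at hs
    rcases eq_or_ne s b with rfl | hsb
    · exact mem_rowBusy.2 ⟨hbd, Or.inl (by omega)⟩
    rcases eq_or_ne s a with rfl | hsa
    · exact mem_rowBusy.2 ⟨by omega, Or.inl (by omega)⟩
    exact hsub (Finset.mem_Ioo.2 (by omega))
  rcases hor with h | h
  · exact ⟨h, hB.mem_of_uIcc h hall⟩
  · exact ⟨hB.mem_of_uIcc h (by rwa [Finset.uIcc_comm]), h⟩

theorem IsBasin.child (hV : IsBasin d χ V) {Cc : Finset ℕ}
    (hCc : ∀ t, t ∈ Cc ↔ V.sup χ ≤ χ t) (h1 : 1 ≤ V.sup χ) {V' : Finset ℕ}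
    (hV' : IsMaxInterval (V \ Cc) V') : IsBasin d χ V' ∧ V'.sup χ < V.sup χ := by
  have hsub : V' ⊆ V := hV'.subset.trans Finset.sdiff_subset
  have hlt : V'.sup χ < V.sup χ := by
    rw [Finset.sup_lt_iff (show (⊥ : ℕ) < V.sup χ from h1)]
    intro t ht
    have := (Finset.mem_sdiff.1 (hV'.subset ht)).2
    rw [hCc] at this
    omega
  refine ⟨⟨hV'.isInterval, fun t ht => hV.le t (hsub ht), fun z hz hadj => ?_⟩, hlt⟩
  rcases hadj.mem_or_adj hsub with h | h
  · have := hV'.notMem_of_adj hadj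
    rw [Finset.mem_sdiff, hCc] at this
    have : V.sup χ ≤ χ z := by tauto
    omega
  · exact hlt.trans (hV.lt_of_adj z hz h)

/-- The basin is the maximal interval around `B` on which `χ` stays at most `B.sup χ`. -/
theorem exists_isBasin (hB : IsInterval B) (hd : ∀ t ∈ B, t ≤ d) :
    ∃ V, IsBasin d χ V ∧ B ⊆ V ∧ V.sup χ = B.sup χ := by
  have hsub : B ⊆ (Finset.Icc 0 d).filter fun t => χ t ≤ B.sup χ := fun t ht =>
    Finset.mem_filter.2 ⟨Finset.mem_Icc.2 ⟨Nat.zero_le _, hd t ht⟩, Finset.le_sup ht⟩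
  obtain ⟨V, hV, hBV⟩ := exists_isMaxInterval_superset hB hsub
  have heq : V.sup χ = B.sup χ := le_antisymm
    (Finset.sup_le fun t ht => (Finset.mem_filter.1 (hV.subset ht)).2) (Finset.sup_mono hBV)
  refine ⟨V, ⟨hV.isInterval, fun t ht => ?_, fun z hz hadj => ?_⟩, hBV, heq⟩
  · exact (Finset.mem_Icc.1 (Finset.mem_filter.1 (hV.subset ht)).1).2
  · have := hV.notMem_of_adj hadj
    simp only [Finset.mem_filter, Finset.mem_Icc] at this
    omega

theorem isBasin_slots : IsBasin d χ (Finset.Icc 0 d) := by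
  refine ⟨⟨0, d, Nat.zero_le d, rfl⟩, fun t ht => (Finset.mem_Icc.1 ht).2, fun z hz hadj => ?_⟩
  exact absurd (Finset.mem_Icc.2 ⟨Nat.zero_le z, hz⟩) hadj.1

end Row

/-! ### Uniqueness and shape of the valleys next to a section. -/

theorem IsLeftValley.eq {C B W W' : Finset ℕ} (h : IsLeftValley C B W)
    (h' : IsLeftValley C B W') : W = W' := by
  obtain ⟨-, ⟨hne, hd, x, hx, y, hy, rfl⟩, t, ht, htl⟩ := h
  obtain ⟨-, ⟨hne', hd', x', hx', y', hy', rfl⟩, t', ht', htl'⟩ := h'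
  have htt := htl.unique htl'
  have h1 := ht.1
  have h1' := ht'.1
  simp only [Finset.coe_Ioo, Set.mem_Ioo] at h1 h1'
  have hyt : y = t + 1 := by
    by_contra hne
    have := ht.2 (show t + 1 ∈ ((Finset.Ioo x y : Finset ℕ) : Set ℕ) by
      simp only [Finset.coe_Ioo, Set.mem_Ioo]; omega)
    omega
  have hyt' : y' = t' + 1 := by
    by_contra hne
    have := ht'.2 (show t' + 1 ∈ ((Finset.Ioo x' y' : Finset ℕ) : Set ℕ) by
      simp only [Finset.coe_Ioo, Set.mem_Ioo]; omega)
    omega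
  have hxx : x = x' := by
    rcases lt_trichotomy x x' with hlt | rfl | hlt
    · exact absurd hx' (Finset.disjoint_left.1 hd (Finset.mem_Ioo.2 (by omega)))
    · rfl
    · exact absurd hx (Finset.disjoint_left.1 hd' (Finset.mem_Ioo.2 (by omega)))
  rw [hxx, hyt, hyt', htt]

theorem IsRightValley.eq {C B W W' : Finset ℕ} (h : IsRightValley C B W)
    (h' : IsRightValley C B W') : W = W' := by
  obtain ⟨-, ⟨hne, hd, x, hx, y, hy, rfl⟩, t, htl, ht⟩ := h
  obtain ⟨-, ⟨hne', hd', x', hx', y', hy', rfl⟩, t', htl', ht'⟩ := h'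
  have htt := htl.unique htl'
  have h1 := ht.1
  have h1' := ht'.1
  simp only [Finset.coe_Ioo, Set.mem_Ioo] at h1 h1'
  have hxt : x = t := by
    by_contra hne
    have := ht.2 (show t ∈ ((Finset.Ioo x y : Finset ℕ) : Set ℕ) by
      simp only [Finset.coe_Ioo, Set.mem_Ioo]; omega)
    omega
  have hxt' : x' = t' := by
    by_contra hne
    have := ht'.2 (show t' ∈ ((Finset.Ioo x' y' : Finset ℕ) : Set ℕ) by
      simp only [Finset.coe_Ioo, Set.mem_Ioo]; omega)
    omega
  have hyy : y = y' := by
    rcases lt_trichotomy y y' with hlt | rfl | hlt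
    · exact absurd hy (Finset.disjoint_left.1 hd' (Finset.mem_Ioo.2 (by omega)))
    · rfl
    · exact absurd hy' (Finset.disjoint_left.1 hd (Finset.mem_Ioo.2 (by omega)))
  rw [hyy, hxt, hxt', htt]

/-- A left valley of a section ends at the section. -/
theorem IsLeftValley.exists_eq_Ioo {C B W : Finset ℕ} (h : IsLeftValley C B W) :
    ∃ x ∈ C, ∃ y ∈ C, x < y ∧ W = Finset.Ioo x y ∧ y ∈ B ∧ x ∉ B := by
  obtain ⟨-, ⟨hne, hd, x, hx, y, hy, rfl⟩, t, ht, htl⟩ := h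
  have h1 := ht.1
  simp only [Finset.coe_Ioo, Set.mem_Ioo] at h1
  have hyt : y = t + 1 := by
    by_contra hne
    have := ht.2 (show t + 1 ∈ ((Finset.Ioo x y : Finset ℕ) : Set ℕ) by
      simp only [Finset.coe_Ioo, Set.mem_Ioo]; omega)
    omega
  have h2 := Finset.mem_inter.1 (Finset.mem_coe.1 htl.1)
  refine ⟨x, hx, y, hy, by omega, rfl, hyt ▸ h2.2, fun hxB => ?_⟩
  have := htl.2 (Finset.mem_coe.2 (Finset.mem_inter.2 ⟨hx, hxB⟩))
  omega

/-- A right valley of a section starts at the section. -/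
theorem IsRightValley.exists_eq_Ioo {C B W : Finset ℕ} (h : IsRightValley C B W) :
    ∃ x ∈ C, ∃ y ∈ C, x < y ∧ W = Finset.Ioo x y ∧ x ∈ B ∧ y ∉ B := by
  obtain ⟨-, ⟨hne, hd, x, hx, y, hy, rfl⟩, t, htl, ht⟩ := h
  have h1 := ht.1
  simp only [Finset.coe_Ioo, Set.mem_Ioo] at h1
  have hxt : x = t := by
    by_contra hne
    have := ht.2 (show t ∈ ((Finset.Ioo x y : Finset ℕ) : Set ℕ) by
      simp only [Finset.coe_Ioo, Set.mem_Ioo]; omega)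
    omega
  have h2 := Finset.mem_inter.1 (Finset.mem_coe.1 htl.1)
  refine ⟨x, hx, y, hy, by omega, rfl, hxt ▸ h2.2, fun hyB => ?_⟩
  have := htl.2 (Finset.mem_coe.2 (Finset.mem_inter.2 ⟨hy, hyB⟩))
  omega

/-! ### The subroutine `close` -/

section Close

variable {J : Type*} {S : Schedule J} {k t : ℕ} {V : Finset ℕ}

theorem le_topBusy {k' : ℕ} (h1 : 1 ≤ k') (hk : k' < k) (h : S k' t ≠ Slot.idle) :
    k' ≤ topBusy S k t := by
  classical
  exact Finset.le_sup (f := id) (Finset.mem_filter.2 ⟨Finset.mem_Ico.2 ⟨h1, hk⟩, h⟩)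

theorem topBusy_spec (h : topBusy S k t ≠ 0) :
    topBusy S k t < k ∧ S (topBusy S k t) t ≠ Slot.idle := by
  classical
  have hne : ((Finset.Ico 1 k).filter fun k' => S k' t ≠ Slot.idle).Nonempty := by
    by_contra hne
    rw [Finset.not_nonempty_iff_eq_empty] at hne
    rw [topBusy, hne] at h
    simp at h
  obtain ⟨k', hk', he⟩ := Finset.exists_mem_eq_sup _ hne id
  have he : topBusy S k t = k' := he
  rw [he]
  have := Finset.mem_filter.1 hk'
  exact ⟨(Finset.mem_Ico.1 this.1).2, this.2⟩

theorem close_above {k' : ℕ} (hk : k < k') : close k V S k' t = S k' t := by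
  unfold close
  split_ifs with h1 h2 h3 h4 h5
  · omega
  · rfl
  · omega
  · have := (topBusy_spec h2).1
    omega
  · rfl
  · rfl

theorem close_self : close k V S k t ≠ Slot.idle ↔ S k t ≠ Slot.idle ∨ t ∈ V := by
  unfold close
  by_cases h : t ∈ V ∧ S k t = Slot.idle
  · rw [if_pos h]
    simp only [if_true]
    refine iff_of_true ?_ (Or.inr h.1)
    split_ifs with h2
    · simp
    · exact (topBusy_spec h2).2
  · rw [if_neg h]
    tauto

theorem close_below {k' : ℕ} (h1 : 1 ≤ k') (hk : k' < k) :
    close k V S k' t ≠ Slot.idle ↔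
      S k' t ≠ Slot.idle ∧ (t ∈ V → S k t = Slot.idle → k' ≠ topBusy S k t) := by
  unfold close
  by_cases h : t ∈ V ∧ S k t = Slot.idle
  · rw [if_pos h, if_neg hk.ne, if_neg hk.ne]
    split_ifs with h2 h3
    · have : k' ≠ topBusy S k t := by omega
      tauto
    · simp only [ne_eq, not_true_eq_false, false_iff]
      tauto
    · tauto
  · rw [if_neg h]
    tauto

end Close

namespace ProblemInstance

variable {J : Type*} [Fintype J] {I : ProblemInstance J} {S : Schedule J} {C : ℕ → Finset ℕ}

/-! ### The states of a row -/

/-- The state `s` of the realignment on processor `k` is determined, as far as busy slots are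
concerned, by the numbers `X` of earlier closings and the valleys closed on `k`. -/
structure RowState (I : ProblemInstance J) (S : Schedule J) (C : ℕ → Finset ℕ) (k : ℕ)
    (X : ℕ → ℕ) (s : RealState J) : Prop where
  closable : ∀ W ∈ s.closed, Closable I.lastDeadline (I.crit S C) k X W
  busy : ∀ t ≤ I.lastDeadline, s.sched k t ≠ Slot.idle ↔
    k + X t ≤ I.augCount S C t ∨ t ∈ s.closed.biUnion id
  below : ∀ k', 1 ≤ k' → k' < k → ∀ t ≤ I.lastDeadline, s.sched k' t ≠ Slot.idle ↔
    k' + (X t + if t ∈ s.closed.biUnion id then 1 else 0) ≤ I.augCount S C t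

theorem RowState.busySlots_eq {k : ℕ} {X : ℕ → ℕ} {s : RealState J}
    (h : I.RowState S C k X s) : I.busySlots s.sched k =
      rowBusy I.lastDeadline (I.augCount S C) k X (s.closed.biUnion id) := by
  ext t
  rw [mem_rowBusy]
  simp only [busySlots, Finset.mem_filter, mem_slots]
  exact and_congr_right fun ht => h.busy t ht

theorem RowState.closeValley {k : ℕ} {X : ℕ → ℕ} {s : RealState J}
    (h : I.RowState S C k X s) {W : Finset ℕ}
    (hW : Closable I.lastDeadline (I.crit S C) k X W) :
    I.RowState S C k X (s.closeValley k W) := by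
  have hmem : ∀ t, t ∈ (s.closeValley k W).closed.biUnion id ↔
      t ∈ W ∨ t ∈ s.closed.biUnion id := fun t => by
    simp [RealState.closeValley]
  refine ⟨fun W' hW' => ?_, fun t ht => ?_, fun k' h1 hk t ht => ?_⟩
  · rcases Finset.mem_insert.1 hW' with rfl | h'
    · exact hW
    · exact h.closable W' h'
  · have h1 := h.busy t ht
    rw [hmem, RealState.closeValley, close_self]
    tauto
  · have hb := h.busy t ht
    have hlow := h.below k' h1 hk t ht
    simp only [hmem]
    rw [RealState.closeValley, close_below h1 hk]
    by_cases htW : t ∈ W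
    · by_cases htZ : t ∈ s.closed.biUnion id
      · have hidle : ¬ s.sched k t = Slot.idle := hb.2 (Or.inr htZ)
        simp only [htZ, or_true, if_true] at hlow ⊢
        tauto
      · simp only [htZ, or_false, if_false, add_zero] at hlow hb
        simp only [htW, true_or, if_true]
        -- If `k` is idle, the busy rows below it are exactly those up to `n t - X t`. Removing the
        -- highest one has the same effect as raising `X t` by one.
        by_cases hidle : s.sched k t = Slot.idle
        · have hn : ¬ (k + X t ≤ I.augCount S C t) := fun h' => hb.2 h' hidle
          simp only [hidle, true_imp_iff]
          rw [hlow]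
          constructor
          · rintro ⟨h3, h4⟩
            by_contra h5
            have h6 : k' ≤ topBusy s.sched k t := le_topBusy h1 hk (hlow.2 h3)
            obtain ⟨h7, h8⟩ := topBusy_spec (S := s.sched) (k := k) (t := t) (by omega)
            have h9 := (h.below _ (by omega) h7 t ht).1 h8
            rw [if_neg htZ] at h9
            omega
          · intro h3
            refine ⟨by omega, fun h4 => ?_⟩
            have h5 : s.sched (k' + 1) t ≠ Slot.idle := by
              rw [h.below (k' + 1) (by omega) (by omega) t ht, if_neg htZ]
              omega
            have := le_topBusy (by omega) (by omega : k' + 1 < k) h5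
            omega
        -- If `k` is already busy, `close` changes nothing at `t`. As `k + X t ≤ n t`, all rows
        -- below `k` stay busy even with the closing counted.
        · have := hb.1 hidle
          have h5 : s.sched k' t ≠ Slot.idle := hlow.2 (by omega)
          simp only [hidle, false_imp_iff, imp_true_iff, and_true]
          exact iff_of_true h5 (by omega)
    · simp only [htW, false_imp_iff, and_true, false_or]
      exact hlow

/-- The state `s'` is reached from `s` by further closings on processor `k`. -/
def Extends (k : ℕ) (s s' : RealState J) : Prop :=
  s.closed ⊆ s'.closed ∧ ∀ k', k < k' → ∀ t, s'.sched k' t = s.sched k' t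

end ProblemInstance
end PLTR

namespace PLTR
namespace ProblemInstance

variable {J : Type*} [Fintype J] {I : ProblemInstance J} {S : Schedule J} {C : ℕ → Finset ℕ}
  {k : ℕ} {X : ℕ → ℕ} {res : Finset ℕ → ℤ} {V : Finset ℕ} {s s' : RealState J}

theorem Extends.refl {J : Type*} (k : ℕ) (s : RealState J) : Extends k s s :=
  ⟨Finset.Subset.refl _, fun _ _ _ => rfl⟩

theorem Extends.trans {J : Type*} {k : ℕ} {s s' s'' : RealState J} (h : Extends k s s') (h' : Extends k s' s'') :
    Extends k s s'' :=
  ⟨h.1.trans h'.1, fun k' hk t => (h'.2 k' hk t).trans (h.2 k' hk t)⟩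

theorem IsCriticalFamily.mem_critSet_iff (hC : I.IsCriticalFamily S C)
    (h2 : 2 ≤ I.critSet S C V) (t : ℕ) :
    t ∈ C (I.critSet S C V) ↔ V.sup (I.crit S C) ≤ I.crit S C t :=
  hC.mem_iff (isUsed_critSet (by omega))

theorem IsCriticalFamily.le_of_mem_critSet (hC : I.IsCriticalFamily S C)
    (h2 : 2 ≤ I.critSet S C V) : ∀ t ∈ C (I.critSet S C V), t ≤ I.lastDeadline :=
  fun _ ht => mem_slots.1 ((hC _ (isUsed_critSet (by omega))).1.subset_slots ht)

/-- The valleys next to a busy interval of low density can be closed, and this makes the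
processor busy at further slots. -/
theorem closable_of_lowBusy (hS : I.Feasible S) (hst : I.Stair S)
    (hC : I.IsCriticalFamily S C) (hk : 1 ≤ k)
    (hX : RowInv I.lastDeadline (I.crit S C) k X) (hs : I.RowState S C k X s)
    (hV : IsBasin I.lastDeadline (I.crit S C) V) (h2 : 2 ≤ I.critSet S C V) {B W : Finset ℕ}
    (hB : I.IsLowBusy S C k V s.sched B)
    (hW : IsLeftValley (C (I.critSet S C V)) B W ∨ IsRightValley (C (I.critSet S C V)) B W) :
    Closable I.lastDeadline (I.crit S C) k X W ∧ ¬ W ⊆ I.busySlots s.sched k := by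
  obtain ⟨hBmax, hBV, hcrit, hpeak⟩ := hB
  rw [IsBusyInterval, hs.busySlots_eq] at hBmax
  have hmem := hC.mem_critSet_iff h2
  have hle := hC.le_of_mem_critSet h2
  have hdisj : Disjoint W (C (I.critSet S C V)) := hW.elim (fun h => h.2.1.2.1) fun h => h.2.1.2.1
  have hlt : ∀ t ∈ W, I.crit S C t < V.sup (I.crit S C) := fun t ht => by
    have h1 := Finset.disjoint_left.1 hdisj ht
    rw [hmem] at h1
    omega
  rw [hs.busySlots_eq]
  rcases hW with hW | hW
  · obtain ⟨x, hx, y, hy, hxy, rfl, hyB, hxB⟩ := hW.exists_eq_Ioo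
    exact closable_of_gap (levelData hS hst hC) hX hk hs.closable hV hBmax hBV h2 hxy
      (hle y hy) ((hmem x).1 hx) ((hmem y).1 hy) hlt (Or.inr hyB) (fun h => hxB h.1)
  · obtain ⟨x, hx, y, hy, hxy, rfl, hxB, hyB⟩ := hW.exists_eq_Ioo
    exact closable_of_gap (levelData hS hst hC) hX hk hs.closable hV hBmax hBV h2 hxy
      (hle y hy) ((hmem x).1 hx) ((hmem y).1 hy) hlt (Or.inl hxB) (fun h => hyB h.2)

theorem CloseStep.rowState (hS : I.Feasible S) (hst : I.Stair S)
    (hC : I.IsCriticalFamily S C) (hk : 1 ≤ k)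
    (hX : RowInv I.lastDeadline (I.crit S C) k X) (hs : I.RowState S C k X s)
    (hV : IsBasin I.lastDeadline (I.crit S C) V) (h2 : 2 ≤ I.critSet S C V)
    (h : I.CloseStep S C k res V s s') :
    I.RowState S C k X s' ∧ Extends k s s' ∧
      (I.busySlots s.sched k).card < (I.busySlots s'.sched k).card := by
  have key : ∃ W, Closable I.lastDeadline (I.crit S C) k X W ∧
      ¬ W ⊆ I.busySlots s.sched k ∧ s' = s.closeValley k W := by
    obtain ⟨B, hB, ⟨W, hW, -, rfl⟩ | ⟨-, W, hW, -, rfl⟩⟩ := h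
    · have := closable_of_lowBusy hS hst hC hk hX hs hV h2 hB (Or.inl hW)
      exact ⟨W, this.1, this.2, rfl⟩
    · have := closable_of_lowBusy hS hst hC hk hX hs hV h2 hB (Or.inr hW)
      exact ⟨W, this.1, this.2, rfl⟩
  obtain ⟨W, hW, hne, rfl⟩ := key
  have hs' := hs.closeValley hW
  refine ⟨hs', ⟨Finset.subset_insert _ _, fun k' hk' t => close_above hk'⟩,
    Finset.card_lt_card ?_⟩
  have hsub : ∀ t, t ≤ I.lastDeadline →
      (t ∈ I.busySlots (s.closeValley k W).sched k ↔ t ∈ I.busySlots s.sched k ∨ t ∈ W) :=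
    fun t ht => by
      rw [mem_busySlots, mem_busySlots, RealState.closeValley, close_self]
      tauto
  rw [Finset.ssubset_iff_of_subset]
  · obtain ⟨t, htW, htb⟩ := Finset.not_subset.1 hne
    obtain ⟨x, y, c, rfl, hxy, hyd, -⟩ := hW
    have := Finset.mem_Ioo.1 htW
    exact ⟨t, (hsub t (by omega)).2 (Or.inr htW), htb⟩
  · intro t ht
    exact (hsub t (mem_busySlots.1 ht).1).2 (Or.inl ht)

/-- The bound on the numbers `N` by which the supplies have been decreased. -/
def SupplyInv (I : ProblemInstance J) (S : Schedule J) (C : ℕ → Finset ℕ) (k : ℕ) (X : ℕ → ℕ)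
    (res : Finset ℕ → ℤ) : Prop :=
  ∃ N : Finset ℕ → ℕ, (∀ W, res W = 2 * ((jobsThrough S W).card : ℤ) - N W) ∧
    ∀ W, ∀ t₀ ≤ I.lastDeadline, (∀ t ∈ W, Sees (I.crit S C) t₀ t) →
      N W ≤ max (X t₀) (I.crit S C t₀ - k)

/-- There is always sufficient supply to close a valley next to a busy interval of low density. -/
theorem exists_closeStep (hS : I.Feasible S) (hst : I.Stair S)
    (hC : I.IsCriticalFamily S C) (hk : 1 ≤ k)
    (hX : RowInv I.lastDeadline (I.crit S C) k X) (hs : I.RowState S C k X s)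
    (hres : I.SupplyInv S C k X res)
    (hV : IsBasin I.lastDeadline (I.crit S C) V) (h2 : 2 ≤ I.critSet S C V) {B : Finset ℕ}
    (hB : I.IsLowBusy S C k V s.sched B) : ∃ s', I.CloseStep S C k res V s s' := by
  classical
  obtain ⟨hBmax, hBV, hcrit, hpeak⟩ := id hB
  rw [IsBusyInterval, hs.busySlots_eq] at hBmax
  have hL := levelData hS hst hC
  have hmem := hC.mem_critSet_iff h2
  have hle := hC.le_of_mem_critSet h2
  have hsec := isSection_of_busy hL hX hk hs.closable hV hBmax hBV hcrit h2 hle hmem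
  set Cc := C (I.critSet S C V) with hCc
  -- The wall `y` of `W` in `B` sees all of `W`, so the decrease of the supply is at most `max (X y)
  -- (c - k)` with `c` the criticality of `V`. By `add_le_of_mem` this is `c - k`.
  have hlow : ∀ W, (IsLeftValley Cc B W ∨ IsRightValley Cc B W) → ¬ 0 < res W →
      2 * (jobsThrough S W).card ≤ I.critSet S C V - k ∧ k ≤ I.critSet S C V := by
    intro W hW hpos
    have hdisj : Disjoint W Cc := hW.elim (fun h => h.2.1.2.1) fun h => h.2.1.2.1
    have hlt : ∀ t ∈ W, I.crit S C t < V.sup (I.crit S C) := fun t ht => by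
      have h1 := Finset.disjoint_left.1 hdisj ht
      rw [hmem] at h1
      omega
    obtain ⟨y, hyB, hyC, hysees⟩ : ∃ y ∈ B, y ∈ Cc ∧ ∀ t ∈ W, Sees (I.crit S C) y t := by
      rcases hW with hW | hW
      · obtain ⟨x, hx, y, hy, hxy, rfl, hyB, hxB⟩ := hW.exists_eq_Ioo
        refine ⟨y, hyB, hy, fun t ht r hr => ?_⟩
        rw [Finset.mem_Ioo] at ht
        rw [Finset.mem_uIcc] at hr
        rcases eq_or_ne r y with rfl | hne
        · exact le_rfl
        · exact (hlt r (Finset.mem_Ioo.2 (by omega))).le.trans ((hmem y).1 hy)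
      · obtain ⟨y, hy, x, hx, hxy, rfl, hyB, hxB⟩ := hW.exists_eq_Ioo
        refine ⟨y, hyB, hy, fun t ht r hr => ?_⟩
        rw [Finset.mem_Ioo] at ht
        rw [Finset.mem_uIcc] at hr
        rcases eq_or_ne r y with rfl | hne
        · exact le_rfl
        · exact (hlt r (Finset.mem_Ioo.2 (by omega))).le.trans ((hmem y).1 hy)
    have hyχ : I.crit S C y = V.sup (I.crit S C) :=
      le_antisymm (Finset.le_sup (hBV hyB)) ((hmem y).1 hyC)
    have hyX := add_le_of_mem hL hX hk hs.closable hV hBmax hBV hyB hyχ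
    obtain ⟨N, hN1, hN2⟩ := hres
    have h3 := hN2 W y (hle y hyC) hysees
    have h4 := hN1 W
    rw [critSet]
    omega
  by_contra hno
  have hl : ∀ W, IsLeftValley Cc B W → ¬ 0 < res W := fun W hW hpos =>
    hno ⟨_, B, hB, Or.inl ⟨W, hW, hpos, rfl⟩⟩
  have hr : ∀ W, IsRightValley Cc B W → ¬ 0 < res W := fun W hW hpos =>
    hno ⟨_, B, hB, Or.inr ⟨fun ⟨W', hW', hpos'⟩ => hl W' hW' hpos', W, hW, hpos, rfl⟩⟩
  have hcB : ∀ t ∈ B, I.crit S C t ≤ I.critSet S C V := fun t ht => Finset.le_sup (hBV ht)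
  have hkc : k ≤ I.critSet S C V := by
    obtain ⟨y, hy, hyχ⟩ := exists_mem_eq_sup (χ := I.crit S C) hBmax.isInterval.nonempty
    have := add_le_of_mem hL hX hk hs.closable hV hBmax hBV hy (hyχ.trans hcrit)
    rw [← hcrit, critSet]
    omega
  -- A missing valley is crossed by no job, so the empty set serves. Adding both sides gives `|Jl| +
  -- |Jr| ≤ c - k`; this is where the factor 2 in the initial supply is needed.
  obtain ⟨Jl, hJl, hJl'⟩ : ∃ Jl : Finset J, (∀ W, IsLeftValley Cc B W → jobsThrough S W ⊆ Jl) ∧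
      2 * Jl.card ≤ I.critSet S C V - k := by
    by_cases h : ∃ W, IsLeftValley Cc B W
    · obtain ⟨W, hW⟩ := h
      exact ⟨jobsThrough S W, fun W' hW' => by rw [hW.eq hW'],
        (hlow W (Or.inl hW) (hl W hW)).1⟩
    · exact ⟨∅, fun W hW => absurd ⟨W, hW⟩ h, by simp⟩
  obtain ⟨Jr, hJr, hJr'⟩ : ∃ Jr : Finset J, (∀ W, IsRightValley Cc B W → jobsThrough S W ⊆ Jr) ∧
      2 * Jr.card ≤ I.critSet S C V - k := by
    by_cases h : ∃ W, IsRightValley Cc B W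
    · obtain ⟨W, hW⟩ := h
      exact ⟨jobsThrough S W, fun W' hW' => by rw [hW.eq hW'],
        (hlow W (Or.inr hW) (hr W hW)).1⟩
    · exact ⟨∅, fun W hW => absurd ⟨W, hW⟩ h, by simp⟩
  have := lt_add_card_of_peakDensity_le hS hst hC (isUsed_critSet (by omega)) hsec hcB hk hpeak
    hJl hJr
  omega

/-! ### Executions of the while-loop and of `fill` -/

theorem reflTransGen_rowState (hS : I.Feasible S) (hst : I.Stair S)
    (hC : I.IsCriticalFamily S C) (hk : 1 ≤ k)
    (hX : RowInv I.lastDeadline (I.crit S C) k X) (hs : I.RowState S C k X s)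
    (hV : IsBasin I.lastDeadline (I.crit S C) V) (h2 : 2 ≤ I.critSet S C V)
    (h : Relation.ReflTransGen (I.CloseStep S C k res V) s s') :
    I.RowState S C k X s' ∧ Extends k s s' := by
  induction h with
  | refl => exact ⟨hs, Extends.refl k s⟩
  | tail _ hstep ih =>
    have := hstep.rowState hS hst hC hk hX ih.1 hV h2
    exact ⟨this.1, ih.2.trans this.2.1⟩

theorem exists_whileRun (hS : I.Feasible S) (hst : I.Stair S)
    (hC : I.IsCriticalFamily S C) (hk : 1 ≤ k)
    (hX : RowInv I.lastDeadline (I.crit S C) k X) (hs : I.RowState S C k X s)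
    (hres : I.SupplyInv S C k X res)
    (hV : IsBasin I.lastDeadline (I.crit S C) V) (h2 : 2 ≤ I.critSet S C V) :
    ∃ s', I.WhileRun S C k res V s s' := by
  -- The measure is the number of slots at which processor `k` is still idle.
  induction hm : I.slots.card - (I.busySlots s.sched k).card using Nat.strong_induction_on
    generalizing s with
  | _ m ih =>
    by_cases h : ∃ B, I.IsLowBusy S C k V s.sched B
    · obtain ⟨B, hB⟩ := h
      obtain ⟨s₁, hstep⟩ := exists_closeStep hS hst hC hk hX hs hres hV h2 hB
      obtain ⟨h1, -, hlt⟩ := hstep.rowState hS hst hC hk hX hs hV h2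
      have hle : (I.busySlots s₁.sched k).card ≤ I.slots.card :=
        Finset.card_le_card (busySlots_subset k)
      obtain ⟨s', hrun, hdone⟩ := ih _ (by omega) h1 rfl
      exact ⟨s', Relation.ReflTransGen.head hstep hrun, hdone⟩
    · exact ⟨s, Relation.ReflTransGen.refl, h⟩

theorem FillList.rowState (hS : I.Feasible S) (hst : I.Stair S)
    (hC : I.IsCriticalFamily S C) (hk : 1 ≤ k)
    (hX : RowInv I.lastDeadline (I.crit S C) k X) {L : List (Finset ℕ)}
    (h : I.FillList S C k res L s s') (hs : I.RowState S C k X s)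
    (hL : ∀ V ∈ L, IsBasin I.lastDeadline (I.crit S C) V) :
    I.RowState S C k X s' ∧ Extends k s s' := by
  induction h with
  | nil => exact ⟨hs, Extends.refl k _⟩
  | skip _ _ ih => exact ih hs fun V hV => hL V (List.mem_cons_of_mem _ hV)
  | @fill V rest children s s₁ s₂ s' h2 hrun _ hch _ _ ih₁ ih₂ =>
    have hV := hL V List.mem_cons_self
    obtain ⟨hs₁, he₁⟩ := reflTransGen_rowState hS hst hC hk hX hs hV h2 hrun.1
    obtain ⟨hs₂, he₂⟩ := ih₁ hs₁ fun V' hV' =>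
      (hV.child (hC.mem_critSet_iff h2) (one_le_two.trans h2) ((hch V').1 hV').1).1
    obtain ⟨hs', he'⟩ := ih₂ hs₂ fun V hV => hL V (List.mem_cons_of_mem _ hV)
    exact ⟨hs', (he₁.trans he₂).trans he'⟩

/-- After `fill(k, V)`, all busy intervals in `V` of criticality at least two are dense. -/
theorem FillList.not_low (hS : I.Feasible S) (hst : I.Stair S)
    (hC : I.IsCriticalFamily S C) (hk : 1 ≤ k)
    (hX : RowInv I.lastDeadline (I.crit S C) k X) {L : List (Finset ℕ)}
    (h : I.FillList S C k res L s s') (hs : I.RowState S C k X s)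
    (hL : ∀ V ∈ L, IsBasin I.lastDeadline (I.crit S C) V) :
    ∀ V ∈ L, ∀ r : RealState J, I.RowState S C k X r → s'.closed ⊆ r.closed →
      ∀ B, I.IsBusyInterval r.sched k B → B ⊆ V → 2 ≤ I.critSet S C B →
        ¬ I.peakDensity B ≤ (k : ℚ) - 1 := by
  induction h with
  | nil => simp
  | @skip V rest s s' h1 _ ih =>
    intro V' hV' r hr hsub B hB hBV hB2
    rcases List.mem_cons.1 hV' with rfl | hV'
    · have : I.critSet S C B ≤ I.critSet S C V' := Finset.sup_mono hBV
      omega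
    · exact ih hs (fun V hV => hL V (List.mem_cons_of_mem _ hV)) V' hV' r hr hsub B hB hBV hB2
  | @fill V rest children s s₁ s₂ s' h2 hrun _ hch hF₁ hF₂ ih₁ ih₂ =>
    have hV := hL V List.mem_cons_self
    obtain ⟨hs₁, he₁⟩ := reflTransGen_rowState hS hst hC hk hX hs hV h2 hrun.1
    have hmem := hC.mem_critSet_iff h2
    have hbas : ∀ V' ∈ children, IsBasin I.lastDeadline (I.crit S C) V' := fun V' hV' =>
      (hV.child hmem (one_le_two.trans h2) ((hch V').1 hV').1).1
    obtain ⟨hs₂, he₂⟩ := hF₁.rowState hS hst hC hk hX hs₁ hbas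
    have hrest : ∀ V ∈ rest, IsBasin I.lastDeadline (I.crit S C) V := fun V hV =>
      hL V (List.mem_cons_of_mem _ hV)
    obtain ⟨hs', he'⟩ := hF₂.rowState hS hst hC hk hX hs₂ hrest
    intro V' hV' r hr hsub B hB hBV hB2
    rcases List.mem_cons.1 hV' with rfl | hV'
    · have hsub₁ : s₁.closed ⊆ r.closed := (he₂.1.trans he'.1).trans hsub
      have hBmax := hB
      rw [IsBusyInterval, hr.busySlots_eq] at hBmax
      have hLD := levelData hS hst hC
      obtain ⟨y, hyB, hyχ⟩ := exists_mem_eq_sup (χ := I.crit S C) hBmax.isInterval.nonempty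
      by_cases hc : I.critSet S C B = I.critSet S C V'
      · have hyX := add_le_of_mem hLD hX hk hr.closable hV hBmax hBV hyB (hyχ.trans hc)
        have hyd := hV.le y (hBV hyB)
        have hn := hLD.le_count y hyd (by rw [hyχ]; exact hB2)
        -- `y` is busy through `k + X y ≤ n y`, independently of any closing on row `k`, hence
        -- already when the while-loop stopped. Its busy interval at that time lies in `B` and would
        -- be another interval for the loop.
        have hy₁ : y ∈ I.busySlots s₁.sched k := by
          rw [hs₁.busySlots_eq]
          exact mem_rowBusy.2 ⟨hyd, Or.inl (hyX.trans hn)⟩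
        obtain ⟨B₁, hB₁, hyB₁⟩ := exists_isMaxInterval hy₁
        have hBB : B₁ ⊆ B := by
          refine hBmax.subset_of_inter hB₁.isInterval (fun t ht => ?_)
            ⟨y, Finset.mem_inter.2 ⟨hyB₁, hyB⟩⟩
          have := hB₁.subset ht
          rw [hs₁.busySlots_eq, mem_rowBusy] at this
          exact mem_rowBusy.2 ⟨this.1, this.2.imp_right fun h' =>
            Finset.biUnion_subset_biUnion_of_subset_left id hsub₁ h'⟩
        intro hpeak
        refine hrun.2 ⟨B₁, hB₁, hBB.trans hBV, le_antisymm ?_ ?_,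
          (peakDensity_mono hBB).trans hpeak⟩
        · rw [← hc]
          exact Finset.sup_mono hBB
        · rw [← hc]
          have : I.crit S C y ≤ I.critSet S C B₁ := Finset.le_sup hyB₁
          rwa [hyχ] at this
      · have hclt : I.critSet S C B < I.critSet S C V' :=
          lt_of_le_of_ne (Finset.sup_mono hBV) hc
        have hBsub : B ⊆ V' \ C (I.critSet S C V') := fun t ht => by
          rw [Finset.mem_sdiff, hmem]
          refine ⟨hBV ht, fun h => ?_⟩
          have h3 : I.crit S C t ≤ I.critSet S C B := Finset.le_sup ht
          exact absurd (h.trans h3) (not_le.2 hclt)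
        obtain ⟨V'', hV'', hBV''⟩ := exists_isMaxInterval_superset hBmax.isInterval hBsub
        -- A closed valley contains no complete busy interval, so `V''` was passed on to a recursive
        -- call.
        have hnot : V'' ∉ s₁.closed := fun hcl =>
          (hs₁.closable V'' hcl).not_subset hLD
            (Finset.subset_biUnion_of_mem id (hsub₁ hcl)) hBmax hBV''
        exact ih₁ hs₁ hbas V'' ((hch V'').2 ⟨hV'', hnot⟩) r hr (he'.1.trans hsub) B hB hBV'' hB2
    · exact ih₂ hs₂ hrest V' hV' r hr hsub B hB hBV hB2

/-- The recursion ends because removing the critical set of `V` strictly lowers the criticality; the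
outer induction is on a bound `c` for it, the inner one on the list. -/
theorem exists_fillList (hS : I.Feasible S) (hst : I.Stair S)
    (hC : I.IsCriticalFamily S C) (hk : 1 ≤ k)
    (hX : RowInv I.lastDeadline (I.crit S C) k X) (hres : I.SupplyInv S C k X res) (c : ℕ)
    (L : List (Finset ℕ)) (hL : ∀ V ∈ L, IsBasin I.lastDeadline (I.crit S C) V)
    (hLc : ∀ V ∈ L, I.critSet S C V ≤ c) (hs : I.RowState S C k X s) :
    ∃ s', I.FillList S C k res L s s' := by
  classical
  induction c generalizing L s with
  | zero =>
    induction L with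
    | nil => exact ⟨s, FillList.nil⟩
    | cons V rest ih =>
      obtain ⟨s', h⟩ := ih (fun V hV => hL V (List.mem_cons_of_mem _ hV))
        (fun V hV => hLc V (List.mem_cons_of_mem _ hV))
      exact ⟨s', FillList.skip ((hLc V List.mem_cons_self).trans zero_le_one) h⟩
  | succ c ihc =>
    induction L generalizing s with
    | nil => exact ⟨s, FillList.nil⟩
    | cons V rest ih =>
      have hrest := fun V hV => hL V (List.mem_cons_of_mem _ hV)
      have hrestc := fun V hV => hLc V (List.mem_cons_of_mem _ hV)
      rcases Nat.lt_or_ge (I.critSet S C V) 2 with h1 | h2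
      · obtain ⟨s', h⟩ := ih hrest hrestc hs
        exact ⟨s', FillList.skip (by omega) h⟩
      · have hV := hL V List.mem_cons_self
        have hVc := hLc V List.mem_cons_self
        obtain ⟨s₁, hrun⟩ := exists_whileRun hS hst hC hk hX hs hres hV h2
        obtain ⟨hs₁, -⟩ := reflTransGen_rowState hS hst hC hk hX hs hV h2 hrun.1
        set F := (V.powerset.filter fun V' =>
          IsMaxInterval (V \ C (I.critSet S C V)) V' ∧ V' ∉ s₁.closed) with hF
        have hch : ∀ V', V' ∈ F.toList ↔
            IsMaxInterval (V \ C (I.critSet S C V)) V' ∧ V' ∉ s₁.closed := fun V' => by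
          rw [Finset.mem_toList, hF, Finset.mem_filter, Finset.mem_powerset]
          exact and_iff_right_of_imp fun h => h.1.subset.trans Finset.sdiff_subset
        have hchild : ∀ V' ∈ F.toList, IsBasin I.lastDeadline (I.crit S C) V' ∧
            I.critSet S C V' < I.critSet S C V := fun V' hV' =>
          hV.child (hC.mem_critSet_iff h2) (one_le_two.trans h2) ((hch V').1 hV').1
        obtain ⟨s₂, hF₁⟩ := ihc F.toList (fun V' hV' => (hchild V' hV').1)
          (fun V' hV' => by have := (hchild V' hV').2; omega) hs₁
        obtain ⟨hs₂, -⟩ := hF₁.rowState hS hst hC hk hX hs₁ fun V' hV' => (hchild V' hV').1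
        obtain ⟨s', hF₂⟩ := ih hrest hrestc hs₂
        exact ⟨s', FillList.fill h2 hrun F.nodup_toList hch hF₁ hF₂⟩

/-! ### The rows of the realignment -/

/-- The invariant of the realignment before processor `k` is treated. -/
structure RealInv (I : ProblemInstance J) (S : Schedule J) (C : ℕ → Finset ℕ) (k : ℕ)
    (X : ℕ → ℕ) (res : Finset ℕ → ℤ) (R : Schedule J) : Prop where
  row : RowInv I.lastDeadline (I.crit S C) k X
  supply : I.SupplyInv S C k X res
  busy : ∀ k', 1 ≤ k' → k' ≤ k → ∀ t ≤ I.lastDeadline, R k' t ≠ Slot.idle ↔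
    k' + X t ≤ I.augCount S C t

theorem RealInv.rowState {R : Schedule J} (h : I.RealInv S C (k + 1) X res R) :
    I.RowState S C (k + 1) X ⟨R, ∅⟩ := by
  refine ⟨by simp, fun t ht => ?_, fun k' h1 hk t ht => ?_⟩
  · simpa using h.busy (k + 1) (by omega) le_rfl t ht
  · simpa using h.busy k' h1 hk.le t ht

theorem RealInv.next {R : Schedule J} (h : I.RealInv S C (k + 1) X res R)
    (hs : I.RowState S C (k + 1) X s) :
    I.RealInv S C k (fun t => X t + if t ∈ s.closed.biUnion id then 1 else 0)
      (updateRes res s.closed) s.sched := by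
  classical
  refine ⟨h.row.next hs.closable, ?_, fun k' h1 hk t ht => hs.below k' h1 (by omega) t ht⟩
  obtain ⟨N, hN1, hN2⟩ := h.supply
  refine ⟨fun W => N W + if ∃ V' ∈ s.closed, (V' ∩ W).Nonempty then 1 else 0,
    fun W => ?_, fun W t₀ h₀ hsee => dec_le_next h.row hs.closable h₀ hsee (hN2 W t₀ h₀ hsee)⟩
  rw [updateRes, hN1 W]
  beta_reduce
  by_cases hW : ∃ V' ∈ s.closed, (V' ∩ W).Nonempty
  · rw [if_pos hW, if_pos hW]
    push_cast
    ring
  · rw [if_neg hW, if_neg hW]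
    simp

theorem exists_realignRows (hS : I.Feasible S) (hst : I.Stair S)
    (hC : I.IsCriticalFamily S C) {R : Schedule J} (h : I.RealInv S C k X res R) :
    ∃ R', I.RealignRows S C k res R R' := by
  induction k generalizing X res R with
  | zero => exact ⟨R, RealignRows.zero⟩
  | succ k ih =>
    have hL : ∀ V ∈ [I.slots], IsBasin I.lastDeadline (I.crit S C) V := fun V hV => by
      rw [List.mem_singleton.1 hV]; exact isBasin_slots
    obtain ⟨s, hs⟩ := exists_fillList hS hst hC (by omega) h.row h.supply
      (I.critSet S C I.slots) [I.slots] hL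
      (fun V hV => by rw [List.mem_singleton.1 hV]) h.rowState
    obtain ⟨hs', -⟩ := hs.rowState hS hst hC (by omega) h.row h.rowState hL
    obtain ⟨R', hR'⟩ := ih (h.next hs')
    exact ⟨R', RealignRows.succ hs hR'⟩

/-- Row `k` of a realigned schedule. -/
theorem RealignRows.spec (hS : I.Feasible S) (hst : I.Stair S)
    (hC : I.IsCriticalFamily S C) {R R' : Schedule J} (h : I.RealInv S C k X res R)
    (hR : I.RealignRows S C k res R R') :
    (∀ k', k < k' → ∀ t, R' k' t = R k' t) ∧
    ∀ k', 1 ≤ k' → k' ≤ k → ∃ Y s, RowInv I.lastDeadline (I.crit S C) k' Y ∧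
      I.RowState S C k' Y s ∧ (∀ t, R' k' t = s.sched k' t) ∧
      ∀ B, I.IsBusyInterval s.sched k' B → 2 ≤ I.critSet S C B →
        ¬ I.peakDensity B ≤ (k' : ℚ) - 1 := by
  induction hR generalizing X with
  | zero => exact ⟨fun _ _ _ => rfl, fun k' h1 h2 => by omega⟩
  | @succ k res R R' s hF hR ih =>
    have hL : ∀ V ∈ [I.slots], IsBasin I.lastDeadline (I.crit S C) V := fun V hV => by
      rw [List.mem_singleton.1 hV]; exact isBasin_slots
    obtain ⟨hs, he⟩ := hF.rowState hS hst hC (by omega) h.row h.rowState hL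
    obtain ⟨ih1, ih2⟩ := ih (h.next hs)
    refine ⟨fun k' hk t => (ih1 k' (by omega) t).trans (he.2 k' hk t), fun k' h1 hk => ?_⟩
    rcases Nat.lt_or_ge k k' with hlt | hle
    · obtain rfl : k' = k + 1 := by omega
      refine ⟨X, s, h.row, hs, fun t => ih1 _ hlt t, fun B hB => ?_⟩
      refine hF.not_low hS hst hC (by omega) h.row h.rowState hL I.slots (by simp) s hs
        (Finset.Subset.refl _) B hB ?_
      exact hB.subset.trans (busySlots_subset _)
    · exact ih2 k' h1 hle

theorem realInv_augment (hS : I.Feasible S) (hst : I.Stair S) :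
    I.RealInv S C I.procs (fun _ => 0) (fun V => 2 * ((jobsThrough S V).card : ℤ))
      (I.augment S C) := by
  refine ⟨⟨fun _ _ _ _ _ => le_rfl, fun _ _ _ _ _ h => absurd h (lt_irrefl _)⟩,
    ⟨fun _ => 0, fun W => by simp, fun _ _ _ _ => Nat.zero_le _⟩, fun k' h1 _ t ht => ?_⟩
  rw [augment_busy_iff hS hst ht, add_zero]
  exact and_iff_right h1

end ProblemInstance
end PLTR

namespace PLTR
namespace ProblemInstance

variable {J : Type*} [Fintype J] {I : ProblemInstance J} {S : Schedule J} {C : ℕ → Finset ℕ}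

/-! ### The last row of the algorithm -/

theorem PltrRow.frozen {k t : ℕ} {b b' : Bounds} (h : I.PltrRow k t b b') :
    ∀ s < t, b'.lower s = b.lower s ∧ b'.upper s = b.upper s := by
  induction h with
  | done _ => exact fun _ _ => ⟨rfl, rfl⟩
  | @step t t₁ t₂ b b' _ h₁ h₂ _ ih =>
    intro s hs
    have h3 := h₁.1.1
    have h4 := h₂.1.1
    obtain ⟨h5, h6⟩ := ih s (by omega)
    rw [h5, h6]
    simp only [Bounds.keepBusy, Bounds.keepIdle]
    rw [if_neg (by omega), if_neg (by omega)]
    exact ⟨rfl, rfl⟩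

theorem PltrRow.mono {t : ℕ} {b b' : Bounds} (h : I.PltrRow 1 t b b') :
    ∀ s, b.lower s ≤ b'.lower s ∧ b'.upper s ≤ b.upper s := by
  induction h with
  | done _ => exact fun _ => ⟨le_rfl, le_rfl⟩
  | step _ _ _ _ ih =>
    intro s
    refine ⟨le_trans ?_ (ih s).1, (ih s).2.trans ?_⟩
    · simp only [Bounds.keepBusy, Bounds.keepIdle]
      split_ifs <;> omega
    · simp only [Bounds.keepBusy, Bounds.keepIdle]
      split_ifs <;> omega

theorem PltrRow.bounds {k t : ℕ} {b b' : Bounds} (h : I.PltrRow (k + 1) t b b')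
    (hb : ∀ s, (b.lower s = 0 ∨ k + 1 ≤ b.lower s) ∧ k ≤ b.upper s) :
    ∀ s, (b'.lower s = 0 ∨ k + 1 ≤ b'.lower s) ∧ k ≤ b'.upper s := by
  induction h with
  | done _ => exact hb
  | step _ _ _ _ ih =>
    refine ih fun s => ?_
    have := hb s
    simp only [Bounds.keepBusy, Bounds.keepIdle]
    split_ifs <;> omega

/-- The bounds with which the last row of the algorithm starts. -/
theorem PltrRows.exists_last {k : ℕ} {b b' : Bounds} (h : I.PltrRows k b b') (hk : 1 ≤ k)
    (hb : ∀ s, (b.lower s = 0 ∨ k + 1 ≤ b.lower s) ∧ k ≤ b.upper s) :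
    ∃ b₀, I.PltrRow 1 0 b₀ b' ∧ ∀ s, (b₀.lower s = 0 ∨ 2 ≤ b₀.lower s) ∧ 1 ≤ b₀.upper s := by
  induction h with
  | zero => omega
  | @succ k b b₁ b' hrow hrows ih =>
    rcases Nat.eq_zero_or_pos k with rfl | hpos
    · cases hrows
      exact ⟨b, hrow, hb⟩
    · exact ih hpos (hrow.bounds fun s => by have := hb s; omega)

/-- No schedule that agrees with the result of the row before an idle slot `z` following a busy
slot can be busy at `z`. -/
theorem PltrRow.not_busy_at_end {t : ℕ} {b b' : Bounds} (h : I.PltrRow 1 t b b') {v : ℕ → ℕ}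
    (hv : ∀ s ≤ I.lastDeadline, b'.lower s ≤ v s ∧ v s ≤ b'.upper s) {z : ℕ} (htz : t < z)
    (hz : z ≤ I.lastDeadline) (hv1 : 1 ≤ v (z - 1)) (hv0 : v z = 0) {S' : Schedule J}
    (hS' : I.Feasible S') (hlt : ∀ s < z, vol S' {s} = v s) (hbusy : 1 ≤ vol S' {z})
    (hge : ∀ s, z ≤ s → s ≤ I.lastDeadline →
      b.lower s ≤ vol S' {s} ∧ vol S' {s} ≤ b.upper s) : False := by
  induction h with
  | done _ => omega
  | @step t t₁ t₂ b b' _ h₁ h₂ hrow ih =>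
    have h3 := h₁.1.1
    have h4 := h₂.1.1
    have hfroz := hrow.frozen
    by_cases hzt : t₂ < z
    · refine ih hv hzt fun s hs hsd => ?_
      have := hge s hs hsd
      simp only [Bounds.keepBusy, Bounds.keepIdle]
      rw [if_neg (by omega), if_neg (by omega)]
      exact this
    -- This is the round in which the busy range ends at `z`: `t₁ ≤ z - 1` as `z - 1` is busy, and
    -- `t₂ = z` as `z` is idle. `S'` then shows that the busy range could be extended by one slot.
    · have ht₁ : t₁ ≤ z - 1 := by
        by_contra hcon
        have h5 := (hv (z - 1) (by omega)).2
        rw [(hfroz (z - 1) (by omega)).2] at h5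
        simp only [Bounds.keepBusy, Bounds.keepIdle] at h5
        rw [if_pos (by omega)] at h5
        omega
      have ht₂ : z = t₂ := by
        by_contra hcon
        have h5 := (hv z hz).1
        rw [(hfroz z (by omega)).1] at h5
        simp only [Bounds.keepBusy, Bounds.keepIdle] at h5
        rw [if_pos (by omega)] at h5
        omega
      have hmem : t₂ + 1 ≤ t₂ := h₂.2 ⟨by omega, by omega, S', hS', fun s hs => ?_⟩
      · omega
      · have hsd := mem_slots.1 hs
        rcases lt_trichotomy s t₂ with hs' | rfl | hs'
        · rw [hlt s (by omega)]
          have h5 := hv s hsd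
          rw [(hfroz s hs').1, (hfroz s hs').2] at h5
          simp only [Bounds.keepBusy, Bounds.keepIdle] at h5 ⊢
          by_cases hs1 : t₁ ≤ s
          · rw [if_pos (by omega)] at h5 ⊢
            exact h5
          · rw [if_neg (by omega)] at h5 ⊢
            exact h5
        · have h5 := hge s (by omega) hsd
          rw [← ht₂] at *
          simp only [Bounds.keepBusy, Bounds.keepIdle]
          rw [if_pos (by omega), if_neg (by omega)]
          omega
        · have h5 := hge s (by omega) hsd
          simp only [Bounds.keepBusy, Bounds.keepIdle]
          rw [if_neg (by omega), if_neg (by omega)]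
          exact h5

/-- No schedule that agrees with the result of the row before an engagement `z` can be idle
at `z`. -/
theorem PltrRow.not_idle_at_start {t : ℕ} {b b' : Bounds} (h : I.PltrRow 1 t b b') {v : ℕ → ℕ}
    (hv : ∀ s ≤ I.lastDeadline, b'.lower s ≤ v s ∧ v s ≤ b'.upper s) {z : ℕ} (htz : t ≤ z)
    (hz : z ≤ I.lastDeadline) (hv1 : t = z ∨ v (z - 1) = 0) (hv0 : 1 ≤ v z) {S' : Schedule J}
    (hS' : I.Feasible S') (hlt : ∀ s < z, vol S' {s} = v s) (hidle : vol S' {z} = 0)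
    (hge : ∀ s, z ≤ s → s ≤ I.lastDeadline →
      b.lower s ≤ vol S' {s} ∧ vol S' {s} ≤ b.upper s) : False := by
  induction h with
  | done _ => omega
  | @step t t₁ t₂ b b' _ h₁ h₂ hrow ih =>
    have h3 := h₁.1.1
    have h4 := h₂.1.1
    have hfroz := hrow.frozen
    by_cases hzt : t₂ ≤ z
    · by_cases htz' : t = z
      · have hmem : z + 1 ≤ t₁ := h₁.2 ⟨by omega, by omega, S', hS', fun s hs => ?_⟩
        · omega
        · have hsd := mem_slots.1 hs
          simp only [Bounds.keepIdle]
          rcases lt_trichotomy s z with hs' | rfl | hs'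
          · rw [hlt s hs', if_neg (by omega)]
            have h5 := hv s hsd
            rw [(hfroz s (by omega)).1, (hfroz s (by omega)).2] at h5
            simp only [Bounds.keepBusy, Bounds.keepIdle] at h5
            rw [if_neg (by omega), if_neg (by omega)] at h5
            exact h5
          · have h5 := hge s le_rfl hsd
            rw [if_pos (by omega)]
            omega
          · have h5 := hge s hs'.le hsd
            rw [if_neg (by omega)]
            exact h5
      · refine ih hv hzt (hv1.imp (fun h => absurd h htz') id) fun s hs hsd => ?_
        have := hge s hs hsd
        simp only [Bounds.keepBusy, Bounds.keepIdle]
        rw [if_neg (by omega), if_neg (by omega)]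
        exact this
    -- This is the round whose idle range ends at `z`: a longer one would forbid the busy slot `z`,
    -- and a shorter one would force `z - 1` to be busy. `S'` shows that the idle range could
    -- include `z`.
    · have ht₁ : t₁ ≤ z := by
        by_contra hcon
        have h5 := (hv z hz).2
        rw [(hfroz z (by omega)).2] at h5
        simp only [Bounds.keepBusy, Bounds.keepIdle] at h5
        rw [if_pos (by omega)] at h5
        omega
      have ht₁' : t₁ = z := by
        by_contra hcon
        have h5 := (hv (z - 1) (by omega)).1
        rw [(hfroz (z - 1) (by omega)).1] at h5
        simp only [Bounds.keepBusy, Bounds.keepIdle] at h5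
        rw [if_pos (by omega)] at h5
        omega
      have hmem : z + 1 ≤ t₁ := h₁.2 ⟨by omega, by omega, S', hS', fun s hs => ?_⟩
      · omega
      · have hsd := mem_slots.1 hs
        simp only [Bounds.keepIdle]
        rcases lt_trichotomy s z with hs' | rfl | hs'
        · rw [hlt s hs']
          have h5 := hv s hsd
          rw [(hfroz s (by omega)).1, (hfroz s (by omega)).2] at h5
          simp only [Bounds.keepBusy, Bounds.keepIdle] at h5
          rw [if_neg (by omega)] at h5
          by_cases hts : t ≤ s
          · rw [if_pos (by omega)] at h5 ⊢
            exact h5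
          · rw [if_neg (by omega)] at h5 ⊢
            exact h5
        · have h5 := hge s le_rfl hsd
          rw [if_pos (by omega)]
          omega
        · have h5 := hge s hs'.le hsd
          rw [if_neg (by omega)]
          exact h5

/-- The schedule `S` with the slots `a` and `b` exchanged. -/
def swapSlots {J : Type*} (S : Schedule J) (a b : ℕ) : Schedule J :=
  fun k t => S k (Equiv.swap a b t)

theorem vol_swapSlots (a b t : ℕ) : vol (swapSlots S a b) {t} = vol S {Equiv.swap a b t} := by
  rw [vol_singleton, vol_singleton]
  rfl

/-- A job that runs alone at `a` can be moved to an idle slot of its execution interval. -/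
theorem Feasible.swapSlots (hS : I.Feasible S) (hst : I.Stair S) {a b : ℕ} {j : J}
    (hj : S 1 a = Slot.job j) (ha : vol S {a} = 1) (hb : vol S {b} = 0)
    (hbj : b ∈ I.exec j) : I.Feasible (swapSlots S a b) := by
  classical
  have had := hS.le_lastDeadline (k := 1) (t := a) (by simp [hj])
  have hbd : b ≤ I.lastDeadline := by
    rw [exec, Finset.mem_Icc] at hbj
    exact hbj.2.trans (Finset.le_sup (f := I.deadline) (Finset.mem_univ j))
  refine ⟨fun k t hk => hS.idle_off_range k _ hk, fun k t => hS.no_aux k _, ?_,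
    fun k k' t i h h' => hS.no_parallel k k' _ i h h', fun i => ?_⟩
  · intro k t i hi
    unfold PLTR.ProblemInstance.swapSlots at hi
    have hk := (hS.busy_iff hst k (Equiv.swap a b t)).1 (by simp [hi])
    by_cases hta : t = a
    · subst hta
      rw [Equiv.swap_apply_left] at hk
      omega
    · by_cases htb : t = b
      · subst htb
        rw [Equiv.swap_apply_right] at hk hi
        obtain rfl : k = 1 := by omega
        rw [hj] at hi
        rwa [← Slot.job.inj hi]
      · rw [Equiv.swap_apply_of_ne_of_ne hta htb] at hi
        exact hS.mem_exec k t i hi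
  · rw [← hS.volume_eq i, volJob, volJob]
    refine Finset.card_equiv (Equiv.swap a b) fun t => ?_
    simp only [Finset.mem_filter, mem_slots]
    refine and_congr ?_ Iff.rfl
    by_cases hta : t = a
    · subst hta
      rw [Equiv.swap_apply_left]
      exact iff_of_true had hbd
    · by_cases htb : t = b
      · subst htb
        rw [Equiv.swap_apply_right]
        exact iff_of_true hbd had
      · rw [Equiv.swap_apply_of_ne_of_ne hta htb]

/-- On the lowest processor, an idle interval of a feasible schedule does not contain the idle
slots directly after two busy intervals which only use the lowest processor. -/
theorem IsPltrSchedule.exists_vol_pos (h : I.IsPltrSchedule S) {S' : Schedule J}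
    (hS' : I.Feasible S') {z p q : ℕ} (hz : 1 ≤ z) (hz1 : 1 ≤ vol S {z - 1})
    (hz0 : vol S {z} = 0) (hzp : z < p) (hp0 : vol S {p - 1} = 0) (hp1 : vol S {p} = 1)
    (hpq : p < q) (hq : q ≤ I.lastDeadline) (hq0 : vol S {q} = 0) :
    ∃ t, z ≤ t ∧ t ≤ q ∧ 1 ≤ vol S' {t} := by
  obtain ⟨hS, hst, b, hrows, hb⟩ := h
  obtain ⟨b₀, hrow, hb₀⟩ := hrows.exists_last I.procs_pos (fun s => by simp)
  have hv : ∀ s ≤ I.lastDeadline, b.lower s ≤ vol S {s} ∧ vol S {s} ≤ b.upper s :=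
    fun s hs => hb s (mem_slots.2 hs)
  have hv₀ : ∀ s ≤ I.lastDeadline, b₀.lower s ≤ vol S {s} ∧ vol S {s} ≤ b₀.upper s :=
    fun s hs => ⟨(hrow.mono s).1.trans (hv s hs).1, (hv s hs).2.trans (hrow.mono s).2⟩
  obtain ⟨j, hj⟩ : ∃ j, S 1 p = Slot.job j := by
    have hne : S 1 p ≠ Slot.idle := (hS.busy_iff hst 1 p).2 ⟨le_rfl, by omega⟩
    cases hj : S 1 p with
    | idle => exact absurd hj hne
    | aux => exact absurd hj (hS.no_aux 1 p)
    | job j => exact ⟨j, rfl⟩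
  have hpj := hS.mem_exec 1 p j hj
  rw [exec, Finset.mem_Icc] at hpj
  -- Otherwise `j` could move from `p` to `z` and prolong the earlier busy range. The bounds before
  -- the last row allow the swap: a slot of volume at most 1 has lower bound 0 there, and all upper
  -- bounds are at least 1.
  have hzj : z < I.release j := by
    by_contra hcon
    have hF := hS.swapSlots hst (a := p) (b := z) hj hp1 hz0
      (by rw [exec, Finset.mem_Icc]; omega)
    refine hrow.not_busy_at_end hv (by omega) (by omega) hz1 hz0 hF (fun s hs => ?_) ?_
      fun s hs hsd => ?_
    · rw [vol_swapSlots, Equiv.swap_apply_of_ne_of_ne (by omega) (by omega)]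
    · rw [vol_swapSlots, Equiv.swap_apply_right, hp1]
    · rw [vol_swapSlots]
      have h1 := hb₀ s
      have h2 := hv₀ s hsd
      by_cases hsp : s = p
      · subst hsp
        rw [Equiv.swap_apply_left, hz0]
        omega
      · by_cases hsz : s = z
        · subst hsz
          rw [Equiv.swap_apply_right, hp1]
          omega
        · rwa [Equiv.swap_apply_of_ne_of_ne hsp hsz]
  -- Otherwise `j` could be postponed to `q`, and the idle range before `p` could be prolonged.
  have hqj : I.deadline j < q := by
    by_contra hcon
    have hF := hS.swapSlots hst (a := p) (b := q) hj hp1 hq0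
      (by rw [exec, Finset.mem_Icc]; omega)
    refine hrow.not_idle_at_start hv (Nat.zero_le p) (by omega) (Or.inr hp0) (by omega) hF
      (fun s hs => ?_) ?_ fun s hs hsd => ?_
    · rw [vol_swapSlots, Equiv.swap_apply_of_ne_of_ne (by omega) (by omega)]
    · rw [vol_swapSlots, Equiv.swap_apply_left, hq0]
    · rw [vol_swapSlots]
      have h1 := hb₀ s
      have h2 := hv₀ s hsd
      by_cases hsp : s = p
      · subst hsp
        rw [Equiv.swap_apply_left, hq0]
        omega
      · by_cases hsq : s = q
        · subst hsq
          rw [Equiv.swap_apply_right, hp1]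
          omega
        · rwa [Equiv.swap_apply_of_ne_of_ne hsp hsq]
  have hpos : 0 < volJob S' j I.slots := by
    rw [hS'.volume_eq, ← hS.volume_eq]
    exact volJob_pos (mem_slots.2 (by omega : p ≤ I.lastDeadline)) ⟨1, hj⟩
  obtain ⟨t, -, ht⟩ := exists_scheduled_of_volJob_pos hpos
  have htj := hS'.mem_exec_of_scheduled ht
  rw [exec, Finset.mem_Icc] at htj
  refine ⟨t, by omega, by omega, ?_⟩
  classical
  rw [vol_singleton]
  exact Finset.card_pos.2 ⟨j, Finset.mem_filter.2 ⟨Finset.mem_univ j, ht⟩⟩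

/-! ### Idle intervals of the realigned schedule -/

/-- Busy intervals of low criticality exist only on the lowest processor, where they are busy
intervals of the original schedule. -/
theorem vol_of_critSet_le_one (hS : I.Feasible S) (hst : I.Stair S)
    (hC : I.IsCriticalFamily S C) {k : ℕ} (hk : 1 ≤ k) {X : ℕ → ℕ}
    (hX : RowInv I.lastDeadline (I.crit S C) k X) {s : RealState J}
    (hs : I.RowState S C k X s) {B : Finset ℕ} (hB : I.IsBusyInterval s.sched k B)
    (hcrit : I.critSet S C B ≤ 1) :
    k = 1 ∧ (∀ t ∈ B, vol S {t} = 1) ∧ ∀ z ≤ I.lastDeadline, Adj z B → vol S {z} = 0 := by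
  have hL := levelData hS hst hC
  rw [IsBusyInterval, hs.busySlots_eq] at hB
  obtain ⟨V, hV, hBV, hVB⟩ := exists_isBasin (χ := I.crit S C) hB.isInterval
    fun t ht => (mem_rowBusy.1 (hB.subset ht)).1
  obtain ⟨y, hy, hyχ⟩ := exists_mem_eq_sup (χ := I.crit S C) hB.isInterval.nonempty
  have hyχ' := hyχ.trans hVB.symm
  have hle := add_le_of_mem hL hX hk hs.closable hV hB hBV hy hyχ'
  have hsup : B.sup (I.crit S C) ≤ 1 := hcrit
  have hmax := (isMaxInterval_of_not_le hL hX hs.closable hV hB hBV hy hyχ' (by omega)).1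
  have hk1 : k + X y = 1 := by omega
  rw [hk1] at hmax
  have hge : ∀ t, vol S {t} ≤ I.augCount S C t := fun t => by
    unfold augCount
    split_ifs <;> omega
  refine ⟨by omega, fun t ht => ?_, fun z hz hadj => ?_⟩
  · have h1 := (Finset.mem_filter.1 (hmax.subset ht))
    have hχ : I.crit S C t ≤ 1 := (Finset.le_sup ht).trans hsup
    have hn : I.augCount S C t = vol S {t} := if_neg (by omega)
    -- A slot of volume at least two would lie in a level-2 interval inside `B`, which contains a
    -- slot of criticality at least two.
    by_contra hne
    obtain ⟨A, hA, htA⟩ := exists_isMaxInterval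
      (A := (Finset.Icc 0 I.lastDeadline).filter fun t => 2 ≤ I.augCount S C t)
      (Finset.mem_filter.2 ⟨h1.1, by omega⟩)
    have hAB : A ⊆ B := hmax.subset_of_inter hA.isInterval (fun r hr => by
      have := Finset.mem_filter.1 (hA.subset hr)
      exact Finset.mem_filter.2 ⟨this.1, by omega⟩) ⟨t, Finset.mem_inter.2 ⟨htA, ht⟩⟩
    have h2 := hL.le_sup 2 A one_le_two hA
    have h3 : A.sup (I.crit S C) ≤ B.sup (I.crit S C) := Finset.sup_mono hAB
    omega
  · have h1 := hmax.notMem_of_adj hadj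
    have h2 := hge z
    simp only [Finset.mem_filter, Finset.mem_Icc] at h1
    omega

theorem exists_busy_between {R : Schedule J} {k p p' : ℕ} {D D' : Finset ℕ}
    (hD : I.IsIdleInterval R k D) (hD' : I.IsIdleInterval R k D') (hne : D ≠ D') (hp : p ∈ D)
    (hp' : p' ∈ D') (hlt : p < p') :
    ∃ q, p < q ∧ q < p' ∧ q ∈ I.busySlots R k := by
  by_contra hno
  push Not at hno
  refine hne (hD.eq_of_mem hD' (hD.mem_of_uIcc hp fun s hs => ?_) hp')
  have h1 := hD.subset hp
  have h2 := hD'.subset hp'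
  simp only [idleSlots, Finset.mem_filter, mem_slots] at h1 h2 ⊢
  rw [Finset.mem_uIcc] at hs
  rcases eq_or_ne s p with rfl | hsp
  · exact h1
  rcases eq_or_ne s p' with rfl | hsp'
  · exact h2
  have h3 := hno s (by omega) (by omega)
  rw [mem_busySlots] at h3
  have : s ≤ I.lastDeadline := by omega
  tauto

theorem exists_busyInterval_between {R : Schedule J} {k p p' q : ℕ} (hp : R k p = Slot.idle)
    (hp' : R k p' = Slot.idle) (hpq : p < q) (hqp : q < p') (hq : q ∈ I.busySlots R k) :
    ∃ a b, p < a ∧ a ≤ b ∧ b < p' ∧ I.IsBusyInterval R k (Finset.Icc a b) := by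
  obtain ⟨B, hB, hqB⟩ := exists_isMaxInterval hq
  obtain ⟨a, b, hab, rfl⟩ := hB.isInterval
  rw [Finset.mem_Icc] at hqB
  refine ⟨a, b, ?_, hab, ?_, hB⟩
  · by_contra hcon
    exact (mem_busySlots.1 (hB.subset (Finset.mem_Icc.2 (by omega : a ≤ p ∧ p ≤ b)))).2 hp
  · by_contra hcon
    exact (mem_busySlots.1 (hB.subset (Finset.mem_Icc.2 (by omega : a ≤ p' ∧ p' ≤ b)))).2 hp'

/-- An idle interval of a feasible schedule with the stair-property does not meet three
successive idle intervals of a realigned schedule. -/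
theorem IsRealigned.not_three (h : I.IsPltrSchedule S) (hC : I.IsCriticalFamily S C)
    {R : Schedule J} (hR : I.IsRealigned S C R) {S' : Schedule J} (hS' : I.Feasible S')
    (hst' : I.Stair S') {k : ℕ} (hk : k ∈ Finset.Icc 1 I.procs) {D : Finset ℕ}
    (hD : I.IsIdleInterval S' k D) {p₁ p₂ p₃ : ℕ} {D₁ D₂ D₃ : Finset ℕ}
    (h₁ : I.IsIdleInterval R k D₁) (h₂ : I.IsIdleInterval R k D₂)
    (h₃ : I.IsIdleInterval R k D₃) (h₁₂ : D₁ ≠ D₂) (h₂₃ : D₂ ≠ D₃) (hp₁ : p₁ ∈ D₁ ∩ D)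
    (hp₂ : p₂ ∈ D₂ ∩ D) (hp₃ : p₃ ∈ D₃ ∩ D) (hlt₁ : p₁ < p₂) (hlt₂ : p₂ < p₃) : False := by
  obtain ⟨hS, hst, -⟩ := id h
  rw [Finset.mem_Icc] at hk
  rw [Finset.mem_inter] at hp₁ hp₂ hp₃
  obtain ⟨X, s, hX, hs, hrow, hdense⟩ :=
    (RealignRows.spec hS hst hC (realInv_augment hS hst) hR).2 k hk.1 hk.2
  have hbusy : I.busySlots R k = I.busySlots s.sched k := by
    ext t
    rw [mem_busySlots, mem_busySlots, hrow]
  have hidle : ∀ {E p}, I.IsIdleInterval R k E → p ∈ E → R k p = Slot.idle := fun hE hp => by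
    have := hE.subset hp
    simp only [idleSlots, Finset.mem_filter] at this
    exact this.2
  have hvol' : ∀ t ∈ D, vol S' {t} < k := fun t ht => by
    have h1 := hD.subset ht
    simp only [idleSlots, Finset.mem_filter] at h1
    have h2 := hS'.busy_iff hst' k t
    by_contra hcon
    exact h2.2 ⟨hk.1, by omega⟩ h1.2
  have hDc : ∀ t, p₁ ≤ t → t ≤ p₃ → t ∈ D := fun t ht ht' =>
    hD.isInterval.uIcc_subset hp₁.2 hp₃.2 (by rw [Finset.mem_uIcc]; omega)
  obtain ⟨q₁, hq₁, hq₁', hqb₁⟩ := exists_busy_between h₁ h₂ h₁₂ hp₁.1 hp₂.1 hlt₁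
  obtain ⟨q₂, hq₂, hq₂', hqb₂⟩ := exists_busy_between h₂ h₃ h₂₃ hp₂.1 hp₃.1 hlt₂
  obtain ⟨a₁, b₁, ha₁, hab₁, hb₁, hB₁⟩ := exists_busyInterval_between (hidle h₁ hp₁.1)
    (hidle h₂ hp₂.1) hq₁ hq₁' hqb₁
  obtain ⟨a₂, b₂, ha₂, hab₂, hb₂, hB₂⟩ := exists_busyInterval_between (hidle h₂ hp₂.1)
    (hidle h₃ hp₃.1) hq₂ hq₂' hqb₂
  rw [IsBusyInterval, hbusy] at hB₁ hB₂
  -- Otherwise `B` is dense and forces more than `k - 1` units per slot into some `Q ⊆ D`, where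
  -- `S'` keeps processor `k` idle.
  have hcrit : ∀ B, I.IsBusyInterval s.sched k B → B ⊆ D → I.critSet S C B ≤ 1 := by
    intro B hB hBD
    by_contra hcon
    obtain ⟨Q, hQB, hQ⟩ := exists_lt_fv_of_lt_peakDensity hk.1
      (not_le.1 (hdense B hB (by omega)))
    have h1 := hS'.fv_le Q
    rw [vol_eq_sum] at h1
    have h2 : ∑ t ∈ Q, vol S' {t} ≤ Q.card • (k - 1) := Finset.sum_le_card_nsmul _ _ _
      fun t ht => by have := hvol' t (hBD (hQB ht)); omega
    rw [smul_eq_mul, mul_comm] at h2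
    omega
  have hsub₁ : Finset.Icc a₁ b₁ ⊆ D := fun t ht => by
    rw [Finset.mem_Icc] at ht
    exact hDc t (by omega) (by omega)
  have hsub₂ : Finset.Icc a₂ b₂ ⊆ D := fun t ht => by
    rw [Finset.mem_Icc] at ht
    exact hDc t (by omega) (by omega)
  obtain ⟨hk1, hv₁, hv₁'⟩ := vol_of_critSet_le_one hS hst hC hk.1 hX hs hB₁ (hcrit _ hB₁ hsub₁)
  obtain ⟨-, hv₂, hv₂'⟩ := vol_of_critSet_le_one hS hst hC hk.1 hX hs hB₂ (hcrit _ hB₂ hsub₂)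
  have hp₃d : p₃ ≤ I.lastDeadline := by
    have := h₃.subset hp₃.1
    simp only [idleSlots, Finset.mem_filter, mem_slots] at this
    exact this.1
  have hadj : ∀ {a b : ℕ}, a ≤ b → Adj (b + 1) (Finset.Icc a b) := fun h => by
    simp only [Adj, Finset.mem_Icc]; omega
  -- Here `k = 1`. The slots `b₁ + 1` and `b₂ + 1` are the idle slots after the two busy intervals,
  -- and both lie between `p₁` and `p₃`, hence in `D`.
  obtain ⟨t, ht1, ht2, ht3⟩ := h.exists_vol_pos hS' (z := b₁ + 1) (p := a₂) (q := b₂ + 1)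
    (by omega) (by
      have := hv₁ b₁ (Finset.mem_Icc.2 ⟨hab₁, le_rfl⟩)
      rw [Nat.add_sub_cancel]; omega)
    (hv₁' _ (by omega) (hadj hab₁)) (by omega)
    (hv₂' _ (by omega) (by simp only [Adj, Finset.mem_Icc]; omega))
    (hv₂ a₂ (Finset.mem_Icc.2 ⟨le_rfl, hab₂⟩)) (by omega) (by omega)
    (hv₂' _ (by omega) (hadj hab₂))
  have := hvol' t (hDc t (by omega) (by omega))
  omega

end ProblemInstance
end PLTR

theorem mainTheorem7 {J : Type*} [Fintype J] (I : PLTR.ProblemInstance J)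
    (Spltr : PLTR.Schedule J) (hSpltr : I.IsPltrSchedule Spltr)
    (C : ℕ → Finset ℕ) (hC : I.IsCriticalFamily Spltr C) :
    (∃ Sreal : PLTR.Schedule J, I.IsRealigned Spltr C Sreal) ∧
    ∀ Sreal : PLTR.Schedule J, I.IsRealigned Spltr C Sreal →
    ∀ Sopt : PLTR.Schedule J, I.Feasible Sopt → I.Stair Sopt →
    ∀ k ∈ Finset.Icc 1 I.procs, ∀ Iopt : Finset ℕ, I.IsIdleInterval Sopt k Iopt →
      {D : Finset ℕ | I.IsIdleInterval Sreal k D ∧ (D ∩ Iopt).Nonempty}.encard ≤ 2 := by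
  refine ⟨PLTR.ProblemInstance.exists_realignRows hSpltr.1 hSpltr.2.1 hC
    (PLTR.ProblemInstance.realInv_augment hSpltr.1 hSpltr.2.1), ?_⟩
  intro R hR S' hS' hst' k hk D hD
  by_contra hcon
  obtain ⟨U, hU, hU3⟩ := Set.exists_subset_encard_eq (k := 3)
    (Order.add_one_le_of_lt (not_le.1 hcon))
  obtain ⟨D₁, D₂, D₃, h₁₂, h₁₃, h₂₃, rfl⟩ := Set.encard_eq_three.1 hU3
  obtain ⟨h₁, p₁, hp₁⟩ := hU (show D₁ ∈ _ by simp)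
  obtain ⟨h₂, p₂, hp₂⟩ := hU (show D₂ ∈ _ by simp)
  obtain ⟨h₃, p₃, hp₃⟩ := hU (show D₃ ∈ _ by simp)
  have hne : ∀ {E E' : Finset ℕ} {p p' : ℕ}, I.IsIdleInterval R k E → I.IsIdleInterval R k E' →
      E ≠ E' → p ∈ E ∩ D → p' ∈ E' ∩ D → p ≠ p' := by
    rintro E E' p _ hE hE' hEE hp hp' rfl
    exact hEE (hE.eq_of_mem hE' (Finset.mem_inter.1 hp).1 (Finset.mem_inter.1 hp').1)
  have n₁₂ := hne h₁ h₂ h₁₂ hp₁ hp₂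
  have n₁₃ := hne h₁ h₃ h₁₃ hp₁ hp₃
  have n₂₃ := hne h₂ h₃ h₂₃ hp₂ hp₃
  -- Six of the eight sign patterns are orderings of the three points; the other two are cyclic and
  -- contradictory.
  rcases lt_or_gt_of_ne n₁₂ with a | a <;> rcases lt_or_gt_of_ne n₁₃ with b | b <;>
    rcases lt_or_gt_of_ne n₂₃ with c | c
  · exact hR.not_three hSpltr hC hS' hst' hk hD h₁ h₂ h₃ h₁₂ h₂₃ hp₁ hp₂ hp₃ a c
  · exact hR.not_three hSpltr hC hS' hst' hk hD h₁ h₃ h₂ h₁₃ h₂₃.symm hp₁ hp₃ hp₂ b c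
  · omega
  · exact hR.not_three hSpltr hC hS' hst' hk hD h₃ h₁ h₂ h₁₃.symm h₁₂ hp₃ hp₁ hp₂ b a
  · exact hR.not_three hSpltr hC hS' hst' hk hD h₂ h₁ h₃ h₁₂.symm h₁₃ hp₂ hp₁ hp₃ a b
  · omega
  · exact hR.not_three hSpltr hC hS' hst' hk hD h₂ h₃ h₁ h₂₃ h₁₃.symm hp₂ hp₃ hp₁ c b
  · exact hR.not_three hSpltr hC hS' hst' hk hD h₃ h₂ h₁ h₂₃.symm h₁₂.symm hp₃ hp₂ hp₁ c a
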